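/- **Setting.** Let $\mathcal A\subset\mathbb R^d$ be finite, $\mathcal X\subset\mathbb R^\ell$, $\mu>0$, and let $\mathcal X_\mu\subset\mathcal X$ be finite with a map $x\mapsto[x]_\mu\in\mathcal X_\mu$ that sends each $x\in\mathcal X$ to an element of $\mathcal X_\mu$ of smallest $L_1$-distance to $x$, with $\|x-[x]_\mu\|\le\mu$. For all $a\in\mathcal A$ and $x_1\in\mathcal X$ let $\dot x=z(x,\pi(x;a))$, $x(0)=x_1$, have exactly one solution on $[0,\infty)$ with values in $\mathcal X$. Let $f:\mathcal A\times\mathcal X\to\mathbb R$ be the reward, $\bar g_i:\mathcal X\to\mathbb R$, $i\in\mathcal I_g=\{1,\dots,q\}$, the immediate constraints, and $g_i(a,x_1)=\inf_{t\ge0}\bar g_i(x(t))>-\infty$ along this solution, with $|g_i(a,x_1)-g_i(a',x_1')|\le L_a\|a-a'\|+L_x\|x_1-x_1'\|$, where $L_a,L_x\ge0$. Put $\mathcal I=\{0,\dots,q\}$, $h(\cdot,0)=f$, $h(\cdot,i)=g_i$ for $i\in\mathcal I_g$. Let $\emptyset\ne S_0\subseteq\mathcal A\times\mathcal X_\mu$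 with $g_i\ge L_x\mu$ on $S_0$ for all $i\in\mathcal I_g$, and fix a nominal $x_0\in\mathcal X_\mu$ and a tolerance $\epsilon$. **Gaussian process.** Let $k$ be a kernel on $\mathcal A\times\mathcal X_\mu\times\mathcal I$. With noise variance $\lambda>0$ in the model, data $\hat y$ at inputs $\zeta_1,\dots,\zeta_m$, $K=(k(\zeta_i,\zeta_j))$ and $k(\zeta)=(k(\zeta,\zeta_j))_j$, the posterior mean is $k(\zeta)(K+\lambda I)^{-1}\hat y$ and the posterior variance is $k(\zeta,\zeta)-k(\zeta)(K+\lambda I)^{-1}k(\zeta)^{T}$. The information capacity is $\gamma_N=\max\tfrac12\log\det(I+\lambda^{-1}K)$ over all sequences of $N$ inputs, repetitions allowed. **Algorithm (GoSafe).** Start with $C_0(a,\tilde x_0,i)=[L_x\mu,\infty)$ if $(a,\tilde x_0)\in S_0$, $i\in\mathcal I_g$, and $C_0=\mathbb R$ otherwise, without data, and with $\mathcal E_f=\emptyset$. Let $C_n=C_{n-1}\cap[\mu_{n-1}\pm\beta_n^{1/2}\sigma_{n-1}]$, where $\mu_{n-1},\sigma_{n-1}$ are the posterior mean and standard deviation after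 iteration $n-1$; let $l_n,u_n$ be the ends of $C_n$, $w_n=u_n-l_n$, and write $D(p,p')=L_a\|a-a'\|+L_x(\|\tilde x_0-\tilde x_0'\|+\mu)$ for $p=(a,\tilde x_0)$, $p'=(a',\tilde x_0')$. The expanders $G_n$ are the $p\in S_n$ with $u_n(p,i)\ge D(p,p')$ for some $p'\notin S_n$ and $i\in\mathcal I_g$; the maximizers $M_n$ are the $(a,x_0)\in S_n$ with $u_n(a,x_0,0)\ge l_n(a',x_0,0)$ for all $(a',x_0)\in S_n$; the border $\partial S_n$ is the set of $y\in\mathcal X_\mu$ with $(a,y)\in S_n$ for some $a$, for which there is $x\in\mathcal X$ with $\|y-x\|<2\mu$ and $(a,[x]_\mu)\notin S_n$ for all $a$. Iteration $n\ge1$ performs the first applicable stage (ties are broken arbitrarily): - S1, if $w_{n-1}>\epsilon$ for some $i\in\mathcal I$ and some pair in $G_{n-1}\cup M_{n-1}$ with initial condition $x_0$: evaluate such a pair with maximal $\max_{i\in\mathcal I}w_{n-1}$; - S2, if $w_{n-1}>\epsilon$ for some $i\in\mathcal I_g$ and some pair in $G_{n-1}$: evaluate a pair in $G_{n-1}$ with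 maximal $\max_{i\in\mathcal I_g}w_{n-1}$; - S3, otherwise: evaluate a pair $(a,\tilde x_0)\notin S_{n-1}\cup\mathcal E_f$ for which some $(a',\tilde x_0)\in S_{n-1}$, with maximal $\max_{i\in\mathcal I}w_{n-1}$ (stop if there is none). The experiment runs the system from $\tilde x_0$ with parameters $a$. If the pair is not in $S_{n-1}$, then at the first time (infimum) at which $[x(t)]_\mu$ is some $b\in\partial S_{n-1}$, the parameters are replaced for good by a backup $a'$ with $(a',b)\in S_{n-1}$ (if the infimum is not attained, $b$ is a border value that $[x(t)]_\mu$ takes at times arbitrarily shortly after it). If no replacement occurs, $h(a,\tilde x_0,i)+v_n(i)$ is observed for all $i\in\mathcal I$ and added to the data; in S3, $S_n=S_{n-1}\cup\{(a,\tilde x_0)\}$, and in S1 and S2, $S_n$ is the union of $S_{n-1}$ and the set of all $p'$ such that for every $i\in\mathcal I_g$ some $p\in S_{n-1}$ has $l_n(p,i)\ge D(p,p')$. If a replacement occurs, $S_n=S_{n-1}$, nothing is observed, and the pair is added to $\mathcal E_f$. A pair is removed from $\mathcal E_f$ once the $b$ at which it was stopped is not in $\partial S_n$. **Theorem.** Assume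 that on $\mathcal A\times\mathcal X_\mu\times\mathcal I$ the surrogate $h$ has norm at most $B$ in the RKHS of $k$; if $k$ vanishes between index $0$ and $\mathcal I_g$ (reward and constraints modelled independently), it is enough that $h$ agrees for the indices $i\in\mathcal I_g$ with an element of norm at most $B$. Assume that the noise vectors $v_n\in\mathbb R^{\mathcal I}$ are $\sigma$-sub-Gaussian, $\sigma>0$: for a filtration $(\mathcal F_n)$ such that $v_n$ is $\mathcal F_n$-measurable and the pair evaluated in iteration $n$ is $\mathcal F_{n-1}$-measurable, $\mathbb E[e^{\langle r,v_n\rangle}\mid\mathcal F_{n-1}]\le e^{\sigma^2\|r\|_2^2/2}$ for all $r\in\mathbb R^{\mathcal I}$. Let $\delta\in(0,1)$ and $$\beta_n^{1/2}\ \ge\ B+\frac{\sigma}{\sqrt\lambda}\sqrt{2\bigl(\gamma_{(n-1)|\mathcal I|}+1+\ln(1/\delta)\bigr)}\qquad(n\ge1);$$ for instance $\beta_n^{1/2}=B+4\sigma\sqrt{\gamma_{(n-1)|\mathcal I|}+1+\ln(1/\delta)}$ if $\lambda\ge 1/8$. Then with probability at least $1-\delta$, $\bar g_i(x_n(t))\ge0$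 for all iterations $n\ge1$, all $t\ge0$ and all $i\in\mathcal I_g$, where $x_n$ is the state trajectory of the experiment in iteration $n$, including those with a backup policy. -/

import Mathlib

open Set Filter Topology MeasureTheory

noncomputable section

/-- The deterministic data of a run of the algorithm.  `P` contains the policy parameters, `E` is
`ℝ^ℓ` with an arbitrary norm (`coord` is its coordinate system), `U` contains the control inputs,
and there are `q` constraints. -/
structure GoSafe (P E U : Type*) [NormedAddCommGroup P] [NormedAddCommGroup E] [NormedSpace ℝ E]
    (ℓ q : ℕ) where
  /-- coordinates of the state space, used for the `L₁`-distance -/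
  coord : Module.Basis (Fin ℓ) ℝ E
  /-- the finite set of policy parameters -/
  A : Finset P
  /-- the state space -/
  X : Set E
  /-- the quantized state space -/
  Xμ : Finset E
  /-- the quantization `x ↦ [x]_μ` -/
  quant : E → Xμ
  /-- the dynamics `dx = z(x, u) dt` -/
  z : E → U → E
  /-- the parameterized policy `u = π(x; a)` -/
  policy : P → E → U
  /-- the immediate constraint functions -/
  gbar : Fin q → E → ℝ
  /-- the reward function -/
  f : P → E → ℝ
  /-- Lipschitz constant in the policy parameters -/
  La : ℝ
  /-- Lipschitz constant in the state -/
  Lx : ℝ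
  /-- discretization parameter -/
  μ : ℝ
  /-- nominal initial condition -/
  x₀ : Xμ
  /-- initial safe set -/
  S₀ : Set (A × Xμ)
  /-- kernel of the Gaussian process over parameters, initial conditions and indices;
  index `0` is the reward, index `i.succ` is constraint `i` -/
  k : (A × Xμ) × Fin (q + 1) → (A × Xμ) × Fin (q + 1) → ℝ
  /-- noise variance in the Gaussian process model -/
  lam : ℝ
  /-- confidence parameters `β_n` -/
  β : ℕ → ℝ
  /-- tolerance in the stage conditions -/
  ε : ℝ

namespace GoSafe

variable {P E U : Type*} [NormedAddCommGroup P] [NormedAddCommGroup E] [NormedSpace ℝ E]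
  {ℓ q : ℕ} (c : GoSafe P E U ℓ q)

/-- Pairs of policy parameters and (quantized) initial conditions. -/
abbrev Pair : Type _ := c.A × c.Xμ

/-- Inputs `(a, x̃₀, i)` of the surrogate. -/
abbrev Input : Type _ := c.Pair × Fin (q + 1)

/-- The `L₁`-distance of two states. -/
def l1dist (x y : E) : ℝ := ∑ j, |c.coord.repr x j - c.coord.repr y j|

/-! ### Dynamics and constraint functions -/

/-- `x` is, on `[0, ∞)`, a trajectory in `X` from `x₁` under the policy with parameters `a`. -/
def IsTrajectory (a : P) (x₁ : E) (x : ℝ → E) : Prop :=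
  x 0 = x₁ ∧ ∀ t ≥ 0, x t ∈ c.X ∧ HasDerivWithinAt x (c.z (x t) (c.policy a (x t))) (Ici 0) t

/-- The values that the immediate constraint `i` takes along the trajectory given by `(a, x₁)`. -/
def constraintValues (i : Fin q) (a : P) (x₁ : E) : Set ℝ :=
  {r | ∃ x, c.IsTrajectory a x₁ x ∧ ∃ t ≥ 0, r = c.gbar i (x t)}

/-- The constraint function `g_i(a, x₁)`: the minimum (infimum) of the immediate constraint along
the trajectory. -/
def g (i : Fin q) (a : P) (x₁ : E) : ℝ := sInf (c.constraintValues i a x₁)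

/-- The surrogate selector function. -/
def h (d : c.Pair) (i : Fin (q + 1)) : ℝ :=
  Fin.cases (c.f d.1 d.2) (fun j => c.g j d.1 d.2) i

/-! ### Gaussian process model -/

/-- A list of experiments: the pair and the `q + 1` noisy observations. -/
abbrev Data : Type _ := List (c.Pair × (Fin (q + 1) → ℝ))

variable {c} in
/-- The input belonging to a scalar observation. -/
def Data.input (L : c.Data) (j : Fin L.length × Fin (q + 1)) : c.Input := ((L.get j.1).1, j.2)

variable {c} in
/-- The vector of all scalar observations. -/
def Data.obs (L : c.Data) (j : Fin L.length × Fin (q + 1)) : ℝ := (L.get j.1).2 j.2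

/-- The covariance matrix of the data, plus `lam` times the identity. -/
def gram (L : c.Data) :
    Matrix (Fin L.length × Fin (q + 1)) (Fin L.length × Fin (q + 1)) ℝ :=
  Matrix.of (fun j j' => c.k (L.input j) (L.input j')) + c.lam • (1 : Matrix _ _ ℝ)

/-- The covariances between a new input and the data. -/
def kvec (L : c.Data) (ζ : c.Input) (j : Fin L.length × Fin (q + 1)) : ℝ := c.k ζ (L.input j)

/-- Posterior mean. -/
def postMean (L : c.Data) (ζ : c.Input) : ℝ :=
  c.kvec L ζ ⬝ᵥ Matrix.mulVec (c.gram L)⁻¹ L.obs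

/-- Posterior standard deviation. -/
def postStd (L : c.Data) (ζ : c.Input) : ℝ :=
  √(c.k ζ ζ - c.kvec L ζ ⬝ᵥ Matrix.mulVec (c.gram L)⁻¹ (c.kvec L ζ))

/-- Information capacity: the largest mutual information between the Gaussian process and `N`
noisy observations of it (inputs may repeat). -/
def infoCapacity (N : ℕ) : ℝ :=
  ⨆ p : Fin N → c.Input,
    1 / 2 * Real.log (1 + c.lam⁻¹ • Matrix.of fun j j' => c.k (p j) (p j')).det

/-! ### Sets of the algorithm -/

/-- What the algorithm knows after an iteration. -/
structure State where
  /-- safe set -/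
  S : Set c.Pair
  /-- observations from the completed experiments -/
  data : c.Data
  /-- lower ends of the contained confidence sets -/
  l : c.Pair → Fin (q + 1) → EReal
  /-- upper ends of the contained confidence sets -/
  u : c.Pair → Fin (q + 1) → EReal
  /-- prematurely stopped experiments, each with the border state at which it was stopped -/
  stopped : Set (c.Pair × c.Xμ)

open Classical in
/-- The initial state. -/
def init : c.State where
  S := c.S₀
  data := []
  l := fun d i => if d ∈ c.S₀ ∧ i ≠ 0 then ((c.Lx * c.μ : ℝ) : EReal) else ⊥
  u := fun _ _ => ⊤
  stopped := ∅

/-- The initial conditions for which some parameters are known to be safe. -/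
def safeStates (S : Set c.Pair) : Set c.Xμ := {y | ∃ a, (a, y) ∈ S}

/-- The border of a safe set. -/
def border (S : Set c.Pair) : Set c.Xμ :=
  {y | y ∈ c.safeStates S ∧ ∃ x ∈ c.X, ‖(y : E) - x‖ < 2 * c.μ ∧ c.quant x ∉ c.safeStates S}

/-- The amount `La ‖a - a'‖ + Lx (‖x̃₀ - x̃₀'‖ + μ)` by which a constraint value at `d` must be
positive for `d'` to be certified. -/
def margin (d d' : c.Pair) : ℝ :=
  c.La * ‖(d.1 : P) - d'.1‖ + c.Lx * (‖(d.2 : E) - d'.2‖ + c.μ)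

/-- Safe set update after experiments in the first two stages. -/
def localUpdate (l : c.Pair → Fin (q + 1) → EReal) (S : Set c.Pair) : Set c.Pair :=
  {d' | ∀ i : Fin q, ∃ d ∈ S, (c.margin d d' : EReal) ≤ l d i.succ} ∪ S

variable {c}

namespace State

variable (s : c.State)

/-- Width of the confidence interval. -/
def w (d : c.Pair) (i : Fin (q + 1)) : EReal := s.u d i - s.l d i

/-- Potential maximizers (for the nominal initial condition). -/
def maximizers : Set c.Pair :=
  {d | d ∈ s.S ∧ d.2 = c.x₀ ∧ ∀ a', (a', c.x₀) ∈ s.S → s.l (a', c.x₀) 0 ≤ s.u d 0}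

/-- Potential expanders. -/
def expanders : Set c.Pair :=
  {d | d ∈ s.S ∧ ∃ d', d' ∉ s.S ∧ ∃ i : Fin q, (c.margin d d' : EReal) ≤ s.u d i.succ}

/-- Candidates of the first stage. -/
def cand1 : Set c.Pair := {d | d ∈ s.expanders ∪ s.maximizers ∧ d.2 = c.x₀}

/-- Candidates of the third stage. -/
def cand3 : Set c.Pair :=
  {d | d ∉ s.S ∧ (∀ y, (d, y) ∉ s.stopped) ∧ d.2 ∈ c.safeStates s.S}

/-- Condition for executing the first stage. -/
def cond1 : Prop := ∃ d ∈ s.cand1, ∃ i, (c.ε : EReal) < s.w d i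

/-- Condition for executing the second stage, if the first one is not executed. -/
def cond2 : Prop := ∃ d ∈ s.expanders, ∃ i : Fin q, (c.ε : EReal) < s.w d i.succ

/-- The third stage is executed if neither of the first two is. -/
def global : Prop := ¬ s.cond1 ∧ ¬ s.cond2

/-- The pair `d` is a possible choice (ties are broken arbitrarily) for the next experiment. -/
def IsQuery (d : c.Pair) : Prop :=
  (s.cond1 ∧ d ∈ s.cand1 ∧ ∀ d' ∈ s.cand1, ⨆ i, s.w d' i ≤ ⨆ i, s.w d i) ∨
  (¬ s.cond1 ∧ s.cond2 ∧ d ∈ s.expanders ∧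
    ∀ d' ∈ s.expanders, ⨆ i : Fin q, s.w d' i.succ ≤ ⨆ i : Fin q, s.w d i.succ) ∨
  (s.global ∧ d ∈ s.cand3 ∧ ∀ d' ∈ s.cand3, ⨆ i, s.w d' i ≤ ⨆ i, s.w d i)

end State

variable (c)

/-! ### Experiments -/

/-- The times at which the quantized state is on the border of the safe set. -/
def hitTimes (S : Set c.Pair) (x : ℝ → E) : Set ℝ := {t | 0 ≤ t ∧ c.quant (x t) ∈ c.border S}

/-- The element of the border that triggers the backup policy at the infimum `τ` of the hitting
times: the quantized state at time `τ`, if that is on the border, and otherwise a value that the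
quantized state takes at times arbitrarily shortly after `τ`. -/
def Triggers (S : Set c.Pair) (x : ℝ → E) (τ : ℝ) (b : c.Xμ) : Prop :=
  b ∈ c.border S ∧
    ((τ ∈ c.hitTimes S x ∧ c.quant (x τ) = b) ∨
      (τ ∉ c.hitTimes S x ∧ ∃ᶠ t in 𝓝[>] τ, c.quant (x t) = b))

/-- An experiment with the pair `d`, given the safe set `S`, that runs without intervention. -/
def Completes (S : Set c.Pair) (d : c.Pair) (x : ℝ → E) : Prop :=
  c.IsTrajectory d.1 d.2 x ∧ (d ∉ S → c.hitTimes S x = ∅)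

/-- An experiment with a pair `d` outside the safe set `S` in which the backup policy is triggered
by the border state `b`: the parameters are replaced by safe ones for `b`. -/
def Intervenes (S : Set c.Pair) (d : c.Pair) (x : ℝ → E) (b : c.Xμ) : Prop :=
  d ∉ S ∧ ∃ y τ, c.IsTrajectory d.1 d.2 y ∧ (c.hitTimes S y).Nonempty ∧
    IsGLB (c.hitTimes S y) τ ∧ c.Triggers S y τ b ∧ (∀ t ∈ Icc 0 τ, x t = y t) ∧
    ∃ a', (a', b) ∈ S ∧ ∃ y', c.IsTrajectory a' (y τ) y' ∧ ∀ t ≥ 0, x (τ + t) = y' t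

/-- The rollout; `trigger` is the border state at which it was stopped, if it was. -/
def IsRollout (S : Set c.Pair) (d : c.Pair) (x : ℝ → E) (trigger : Option c.Xμ) : Prop :=
  match trigger with
  | none => c.Completes S d x
  | some b => c.Intervenes S d x b

/-! ### The algorithm -/

open Classical in
/-- The update in iteration `n ≥ 1`, from the state `s` after iteration `n - 1`, if the experiment
was made with the pair `d`, its outcome was `trigger`, and `y` are the noisy observations. -/
def update (n : ℕ) (s : c.State) (d : c.Pair) (trigger : Option c.Xμ) (y : Fin (q + 1) → ℝ) :
    c.State :=
  let l' := fun d i =>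
    max (s.l d i) ((c.postMean s.data (d, i) - √(c.β n) * c.postStd s.data (d, i) : ℝ) : EReal)
  let u' := fun d i =>
    min (s.u d i) ((c.postMean s.data (d, i) + √(c.β n) * c.postStd s.data (d, i) : ℝ) : EReal)
  let S' := match trigger with
    | none => if s.global then s.S ∪ {d} else c.localUpdate l' s.S
    | some _ => s.S
  { S := S'
    data := match trigger with
      | none => s.data ++ [(d, y)]
      | some _ => s.data
    l := l'
    u := u'
    stopped := {e | (e ∈ s.stopped ∨ (e.1 = d ∧ trigger = some e.2)) ∧ e.2 ∈ c.border S'} }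

/-- A run of the algorithm for the noise sequence `v`.  Here `state n` is the state after iteration
`n`, and `query n`, `x n`, `trigger n` belong to iteration `n ≥ 1`: the pair chosen for the experiment
(`none` if the algorithm has nothing left to evaluate), the state trajectory during the experiment,
and the border state at which it was stopped, if it was. -/
structure IsRun (v : ℕ → Fin (q + 1) → ℝ) (state : ℕ → c.State) (query : ℕ → Option c.Pair)
    (x : ℕ → ℝ → E) (trigger : ℕ → Option c.Xμ) : Prop where
  start : state 0 = c.init
  halt : ∀ n, query (n + 1) = none →
    (∀ d, ¬ (state n).IsQuery d) ∧ state (n + 1) = state n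
  step : ∀ n d, query (n + 1) = some d →
    (state n).IsQuery d ∧
    c.IsRollout (state n).S d (x (n + 1)) (trigger (n + 1)) ∧
    state (n + 1) =
      c.update (n + 1) (state n) d (trigger (n + 1)) (fun i => c.h d i + v (n + 1) i)

end GoSafe

/-- The noise vectors `v n`, `n ≥ 1`, are adapted to `ℱ` and conditionally `σ`-sub-Gaussian given
the past. -/
def SubGaussianNoise {Ω : Type*} [mΩ : MeasurableSpace Ω] (ℙ : Measure Ω) (ℱ : Filtration ℕ mΩ)
    (σ : ℝ) {ι : Type*} [Fintype ι] (v : ℕ → ι → Ω → ℝ) : Prop :=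
  ∀ n, (∀ i, Measurable[ℱ (n + 1)] (v (n + 1) i)) ∧
    ∀ r : ι → ℝ, Integrable (fun ω => Real.exp (∑ i, r i * v (n + 1) i ω)) ℙ ∧
      ∀ᵐ ω ∂ℙ, (ℙ[fun ω => Real.exp (∑ i, r i * v (n + 1) i ω) | ℱ n]) ω ≤
        Real.exp (σ ^ 2 / 2 * ∑ i, r i ^ 2)

end

/-! The proof has a deterministic and a probabilistic half.

Deterministic half: suppose that the confidence intervals contain the constraint values. The
invariant is `GoSafe.IsSafeSet`: all pairs in S satisfy the constraints, those starting on the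
border do so with reserve Lx μ, and every safe initial condition has some parameters with this
reserve. By continuity, a trajectory cannot leave the region of safe quantized states without its
quantization meeting the border (`GoSafe.quant_mem_safeStates`). Inside the region the immediate
constraints hold, since some parameters would be safe from the current state; at the border, the
reserve of the backup absorbs the quantization error. Local updates create the reserve by Lipschitz
continuity. A pair added by global exploration may lack it, but it cannot start on the border, as it
would have been stopped at time 0.

Probabilistic half: on a finite input set the kernel has finitely many features, so the posterior
mean is a ridge estimate. Its error is at most the posterior deviation times B plus a
self-normalized norm of the accumulated noise over √lam (`abs_dotProduct_sub_ridge_le`). Averaging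
exponential supermartingales over a Gaussian direction gives `mixture`, which has expectation at
most 1; with a stopping argument it stays below 1/δ at all times, outside an event of probability at
most δ. Its determinant factor is controlled by the information capacity. This one event serves all
constraints and iterations, without a union bound. The noise bound applies because the pairs that
enter the data are predictable (`GoSafe.adapted`): interventions depend only on the safe set and the
pair. -/

section LinearAlgebra

/-! ### Linear algebra of positive definite matrices -/

open Matrix

variable {J κ : Type*} [Fintype J] [Fintype κ]

theorem Matrix.PosSemidef.dotProduct_mulVec_comm {M : Matrix κ κ ℝ} (hM : M.PosSemidef)
    (a b : κ → ℝ) : a ⬝ᵥ M *ᵥ b = b ⬝ᵥ M *ᵥ a := by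
  have h : Mᵀ = M := by
    simpa [conjTranspose_eq_transpose_of_trivial] using hM.isHermitian.eq
  rw [dotProduct_mulVec, dotProduct_comm, ← mulVec_transpose, h]

/-- Cauchy–Schwarz, from the discriminant of the nonnegative quadratic polynomial t ↦ (a + t b)ᵀ M
(a + t b). -/
theorem Matrix.PosSemidef.abs_dotProduct_mulVec_le {M : Matrix κ κ ℝ} (hM : M.PosSemidef)
    (a b : κ → ℝ) : |a ⬝ᵥ M *ᵥ b| ≤ √(a ⬝ᵥ M *ᵥ a) * √(b ⬝ᵥ M *ᵥ b) := by
  have hq (t : ℝ) :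
      0 ≤ (b ⬝ᵥ M *ᵥ b) * (t * t) + (2 * (a ⬝ᵥ M *ᵥ b)) * t + a ⬝ᵥ M *ᵥ a := by
    have h := hM.dotProduct_mulVec_nonneg (a + t • b)
    simp only [star_trivial, mulVec_add, mulVec_smul, dotProduct_add, add_dotProduct,
      smul_dotProduct, dotProduct_smul, smul_eq_mul, hM.dotProduct_mulVec_comm b a] at h
    linarith
  have hd := discrim_le_zero hq
  have ha : 0 ≤ a ⬝ᵥ M *ᵥ a := by simpa using hM.dotProduct_mulVec_nonneg a
  rw [← Real.sqrt_mul ha]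
  refine Real.abs_le_sqrt ?_
  unfold discrim at hd
  linarith

variable [DecidableEq κ]

theorem posDef_smul_one_add_transpose_mul_self {lam : ℝ} (hlam : 0 < lam) (A : Matrix J κ ℝ) :
    (lam • (1 : Matrix κ κ ℝ) + Aᵀ * A).PosDef := by
  have h := posSemidef_conjTranspose_mul_self A
  rw [conjTranspose_eq_transpose_of_trivial] at h
  exact (Matrix.PosDef.one.smul hlam).add_posSemidef h

theorem Matrix.PosDef.mul_inv_self {V : Matrix κ κ ℝ} (hV : V.PosDef) : V * V⁻¹ = 1 :=
  Matrix.mul_nonsing_inv _ hV.det_pos.ne'.isUnit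

theorem Matrix.PosDef.inv_mul_self {V : Matrix κ κ ℝ} (hV : V.PosDef) : V⁻¹ * V = 1 :=
  Matrix.nonsing_inv_mul _ hV.det_pos.ne'.isUnit

theorem Matrix.PosDef.dotProduct_inv_nonneg {V : Matrix κ κ ℝ} (hV : V.PosDef) (a : κ → ℝ) :
    0 ≤ a ⬝ᵥ V⁻¹ *ᵥ a := by
  simpa using hV.inv.posSemidef.dotProduct_mulVec_nonneg a

/-- Every eigenvalue of 1 + M is at least 1, as M has a nonnegative quadratic form on its
eigenvector. -/
theorem one_le_det_one_add {M : Matrix κ κ ℝ} (hM : M.PosSemidef) : 1 ≤ (1 + M).det := by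
  have hA : (1 + M).PosDef := Matrix.PosDef.one.add_posSemidef hM
  rw [hA.isHermitian.det_eq_prod_eigenvalues]
  rw [← Finset.prod_const_one (s := (Finset.univ : Finset κ))]
  refine Finset.prod_le_prod (fun _ _ => zero_le_one) fun i _ => ?_
  set v : κ → ℝ := ⇑(hA.isHermitian.eigenvectorBasis i) with hv
  have h1 : (1 + M) *ᵥ v = hA.isHermitian.eigenvalues i • v :=
    hA.isHermitian.mulVec_eigenvectorBasis i
  have h2 := hM.dotProduct_mulVec_nonneg v
  have hv0 : 0 < v ⬝ᵥ v := by
    refine lt_of_le_of_ne (Finset.sum_nonneg fun i _ => mul_self_nonneg _) fun h => ?_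
    refine hA.isHermitian.eigenvectorBasis.orthonormal.ne_zero i ?_
    ext j
    exact congrFun (dotProduct_self_eq_zero.1 h.symm) j
  rw [add_mulVec, one_mulVec] at h1
  rw [eq_sub_of_add_eq' h1, star_trivial, dotProduct_sub, dotProduct_smul, smul_eq_mul] at h2
  simp only [RCLike.ofReal_real_eq_id, id]
  by_contra! hlt
  nlinarith

/-- By the matrix determinant lemma the quotient is det(1 + A V⁻¹ Aᵀ). Extra observations thus only
increase the determinant. -/
theorem det_le_det_add_transpose_mul_self {V : Matrix κ κ ℝ} (hV : V.PosDef) (A : Matrix J κ ℝ) :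
    V.det ≤ (V + Aᵀ * A).det := by
  classical
  have h := (hV.inv.posSemidef.mul_mul_conjTranspose_same A)
  rw [conjTranspose_eq_transpose_of_trivial] at h
  rw [det_add_mul _ _ hV.det_pos.ne'.isUnit]
  exact le_mul_of_one_le_right hV.det_pos.le (one_le_det_one_add h)

theorem inv_mulVec_transpose_mul_self {lam : ℝ} (hlam : 0 < lam) (A : Matrix J κ ℝ) (p : κ → ℝ) :
    (lam • (1 : Matrix κ κ ℝ) + Aᵀ * A)⁻¹ *ᵥ ((Aᵀ * A) *ᵥ p) =
      p - lam • (lam • (1 : Matrix κ κ ℝ) + Aᵀ * A)⁻¹ *ᵥ p := by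
  have hV := posDef_smul_one_add_transpose_mul_self hlam A
  have h : Aᵀ * A = (lam • (1 : Matrix κ κ ℝ) + Aᵀ * A) - lam • (1 : Matrix κ κ ℝ) := by simp
  conv_lhs => rw [h, sub_mulVec, mulVec_sub, ← h, mulVec_mulVec, hV.inv_mul_self, one_mulVec,
    smul_mulVec, one_mulVec, mulVec_smul]

/-! ### Ridge regression -/

section Ridge

variable [DecidableEq J] {lam : ℝ} (A : Matrix J κ ℝ)

/-- The push-through identity, from V Aᵀ = Aᵀ G. It moves the posterior from the space of
observations to the space of features, whose dimension does not grow with the data. -/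
theorem transpose_mul_inv_gram (hlam : 0 < lam) :
    Aᵀ * (A * Aᵀ + lam • (1 : Matrix J J ℝ))⁻¹ = (lam • (1 : Matrix κ κ ℝ) + Aᵀ * A)⁻¹ * Aᵀ := by
  have hV := posDef_smul_one_add_transpose_mul_self hlam A
  have hG := posDef_smul_one_add_transpose_mul_self hlam Aᵀ
  rw [transpose_transpose, add_comm] at hG
  set V := lam • (1 : Matrix κ κ ℝ) + Aᵀ * A with hVdef
  set G := A * Aᵀ + lam • (1 : Matrix J J ℝ) with hGdef
  have hc : V * Aᵀ = Aᵀ * G := by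
    simp [hVdef, hGdef, Matrix.add_mul, Matrix.mul_add, Matrix.mul_assoc, add_comm]
  calc Aᵀ * G⁻¹ = V⁻¹ * V * Aᵀ * G⁻¹ := by rw [hV.inv_mul_self, Matrix.one_mul]
    _ = V⁻¹ * Aᵀ * (G * G⁻¹) := by rw [Matrix.mul_assoc V⁻¹, hc]; simp only [Matrix.mul_assoc]
    _ = V⁻¹ * Aᵀ := by rw [hG.mul_inv_self, Matrix.mul_one]

theorem mulVec_dotProduct_inv_gram (hlam : 0 < lam) (p : κ → ℝ) (y : J → ℝ) :
    (A *ᵥ p) ⬝ᵥ (A * Aᵀ + lam • (1 : Matrix J J ℝ))⁻¹ *ᵥ y =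
      p ⬝ᵥ (lam • (1 : Matrix κ κ ℝ) + Aᵀ * A)⁻¹ *ᵥ (Aᵀ *ᵥ y) := by
  rw [mulVec_mulVec, ← transpose_mul_inv_gram A hlam, ← mulVec_mulVec, dotProduct_mulVec p,
    vecMul_transpose]

theorem dotProduct_sub_dotProduct_inv_gram (hlam : 0 < lam) (p : κ → ℝ) :
    p ⬝ᵥ p - (A *ᵥ p) ⬝ᵥ (A * Aᵀ + lam • (1 : Matrix J J ℝ))⁻¹ *ᵥ (A *ᵥ p) =
      lam * (p ⬝ᵥ (lam • (1 : Matrix κ κ ℝ) + Aᵀ * A)⁻¹ *ᵥ p) := by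
  rw [mulVec_dotProduct_inv_gram A hlam, mulVec_mulVec p, inv_mulVec_transpose_mul_self hlam A,
    dotProduct_sub, dotProduct_smul, smul_eq_mul, sub_sub_cancel]

theorem dotProduct_inv_le (hlam : 0 < lam) (w : κ → ℝ) :
    lam * (w ⬝ᵥ (lam • (1 : Matrix κ κ ℝ) + Aᵀ * A)⁻¹ *ᵥ w) ≤ w ⬝ᵥ w := by
  have h := dotProduct_sub_dotProduct_inv_gram A hlam w
  have hG := posDef_smul_one_add_transpose_mul_self hlam Aᵀ
  rw [transpose_transpose, add_comm] at hG
  have := hG.dotProduct_inv_nonneg (A *ᵥ w)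
  linarith

/-- The ridge regression estimate at `p` of a linear function `w`, from the response
`AᵀA w + s + r`, where `r` does not influence the estimate. -/
theorem abs_dotProduct_sub_ridge_le (hlam : 0 < lam) (p w s r : κ → ℝ) {B : ℝ}
    (hB : √(w ⬝ᵥ w) ≤ B) (hr : p ⬝ᵥ (lam • (1 : Matrix κ κ ℝ) + Aᵀ * A)⁻¹ *ᵥ r = 0) :
    |p ⬝ᵥ w - p ⬝ᵥ (lam • (1 : Matrix κ κ ℝ) + Aᵀ * A)⁻¹ *ᵥ ((Aᵀ * A) *ᵥ w + s + r)| ≤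
      √(lam * (p ⬝ᵥ (lam • (1 : Matrix κ κ ℝ) + Aᵀ * A)⁻¹ *ᵥ p)) *
        (B + √(s ⬝ᵥ (lam • (1 : Matrix κ κ ℝ) + Aᵀ * A)⁻¹ *ᵥ s) / √lam) := by
  have hV := posDef_smul_one_add_transpose_mul_self hlam A
  have hw := dotProduct_inv_le A hlam w
  have hi := inv_mulVec_transpose_mul_self hlam A w
  set V := lam • (1 : Matrix κ κ ℝ) + Aᵀ * A
  have hl : 0 < √lam := Real.sqrt_pos.2 hlam
  rw [mulVec_add, mulVec_add, dotProduct_add, dotProduct_add, hr, hi, dotProduct_sub,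
    dotProduct_smul, smul_eq_mul]
  -- The error is a regularization bias lam pᵀV⁻¹w minus a noise term pᵀV⁻¹s. Cauchy–Schwarz for V⁻¹
  -- extracts the same factor from both; then `h3` bounds the bias by the norm of w.
  have h1 := hV.inv.posSemidef.abs_dotProduct_mulVec_le p w
  have h2 := hV.inv.posSemidef.abs_dotProduct_mulVec_le p s
  have h3 : √lam * √(w ⬝ᵥ V⁻¹ *ᵥ w) ≤ B := by
    rw [← Real.sqrt_mul hlam.le]
    exact (Real.sqrt_le_sqrt hw).trans hB
  rw [Real.sqrt_mul hlam.le]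
  set P := √(p ⬝ᵥ V⁻¹ *ᵥ p) with hP
  have hP0 : 0 ≤ P := Real.sqrt_nonneg _
  calc _ = |lam * (p ⬝ᵥ V⁻¹ *ᵥ w) - p ⬝ᵥ V⁻¹ *ᵥ s| := by congr 1; ring
    _ ≤ |lam * (p ⬝ᵥ V⁻¹ *ᵥ w)| + |p ⬝ᵥ V⁻¹ *ᵥ s| := abs_sub _ _
    _ ≤ lam * (P * √(w ⬝ᵥ V⁻¹ *ᵥ w)) + P * √(s ⬝ᵥ V⁻¹ *ᵥ s) := by
      rw [abs_mul, abs_of_pos hlam]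
      gcongr
    _ = √lam * P * (√lam * √(w ⬝ᵥ V⁻¹ *ᵥ w) + √(s ⬝ᵥ V⁻¹ *ᵥ s) / √lam) := by
      field_simp
      rw [Real.sq_sqrt hlam.le, mul_comm lam]
    _ ≤ _ := by gcongr

end Ridge

/-- A regression target orthogonal to the regressors of one class only depends on the others, if
the classes are orthogonal to each other. -/
theorem dotProduct_inv_eq_zero_of_orthogonal {lam : ℝ} (hlam : 0 < lam) (A : Matrix J κ ℝ)
    (C : Set J) (hC : ∀ j ∈ C, ∀ j' ∉ C, A j ⬝ᵥ A j' = 0) (p : κ → ℝ)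
    (hp : ∀ j ∈ C, A j ⬝ᵥ p = 0) (e : J → ℝ) (he : ∀ j ∉ C, e j = 0) :
    p ⬝ᵥ (lam • (1 : Matrix κ κ ℝ) + Aᵀ * A)⁻¹ *ᵥ (Aᵀ *ᵥ e) = 0 := by
  classical
  have hV := posDef_smul_one_add_transpose_mul_self hlam A
  have hu : (lam • (1 : Matrix κ κ ℝ) + Aᵀ * A) *ᵥ
      ((lam • (1 : Matrix κ κ ℝ) + Aᵀ * A)⁻¹ *ᵥ p) = p := by
    rw [mulVec_mulVec, hV.mul_inv_self, one_mulVec]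
  rw [hV.inv.posSemidef.dotProduct_mulVec_comm]
  set u := (lam • (1 : Matrix κ κ ℝ) + Aᵀ * A)⁻¹ *ᵥ p with hudef
  -- The aim is that u = V⁻¹p is orthogonal to the rows in C. Here c collects the offending products
  -- and z is the combination of rows with these weights. As z ⊥ p, pairing V u = p with z gives lam
  -- c·c + z·z = 0, so c = 0.
  set c : J → ℝ := fun j => if j ∈ C then A j ⬝ᵥ u else 0 with hc
  set z := Aᵀ *ᵥ c with hz
  have hAu : ∀ j, (A *ᵥ u) j = A j ⬝ᵥ u := fun j => rfl
  have hzA (y : κ → ℝ) : z ⬝ᵥ y = c ⬝ᵥ A *ᵥ y := by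
    rw [hz, mulVec_transpose, ← dotProduct_mulVec]
  have hzp : z ⬝ᵥ p = 0 := by
    rw [hzA]
    refine Finset.sum_eq_zero fun j _ => ?_
    by_cases hj : j ∈ C
    · rw [show (A *ᵥ p) j = 0 from hp j hj, mul_zero]
    · simp [hc, hj]
  have hcc : c ⬝ᵥ A *ᵥ u = c ⬝ᵥ c := by
    refine Finset.sum_congr rfl fun j _ => ?_
    by_cases hj : j ∈ C <;> simp [hc, hj, hAu]
  have hzz : z ⬝ᵥ (Aᵀ *ᵥ (A *ᵥ u)) = z ⬝ᵥ z := by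
    have : z ⬝ᵥ (Aᵀ *ᵥ (A *ᵥ u - c)) = 0 := by
      rw [dotProduct_mulVec, vecMul_transpose]
      refine Finset.sum_eq_zero fun j _ => ?_
      by_cases hj : j ∈ C
      · simp [hc, hj, hAu]
      · have : (A *ᵥ z) j = 0 := by
          change A j ⬝ᵥ z = 0
          rw [dotProduct_comm, hzA]
          refine Finset.sum_eq_zero fun j' _ => ?_
          by_cases hj' : j' ∈ C
          · rw [show (A *ᵥ A j) j' = 0 from hC j' hj' j hj, mul_zero]
          · simp [hc, hj']
        rw [this, zero_mul]
    rw [mulVec_sub, dotProduct_sub, ← hz] at this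
    linarith
  have h0 : lam * (c ⬝ᵥ c) + z ⬝ᵥ z = 0 := by
    rw [← hzz, ← hcc, ← hzA, ← hzp, mulVec_mulVec]
    conv_rhs => rw [← hu]
    rw [add_mulVec, smul_mulVec, one_mulVec, dotProduct_add, dotProduct_smul, smul_eq_mul]
  have hc0 : c = 0 := by
    have h1 : 0 ≤ c ⬝ᵥ c := Finset.sum_nonneg fun i _ => mul_self_nonneg _
    have h2 : 0 ≤ z ⬝ᵥ z := Finset.sum_nonneg fun i _ => mul_self_nonneg _
    exact dotProduct_self_eq_zero.1 (le_antisymm (by nlinarith) h1)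
  rw [mulVec_transpose, ← dotProduct_mulVec]
  refine Finset.sum_eq_zero fun j _ => ?_
  by_cases hj : j ∈ C
  · have := congrFun hc0 j
    simp only [hc, hj, if_true, Pi.zero_apply] at this
    rw [hAu, this, mul_zero]
  · rw [he j hj, zero_mul]

end LinearAlgebra

/-! ### Gaussian integrals -/

section GaussianMixture

open Matrix

variable {κ : Type*} [Fintype κ]

theorem lintegral_exp_neg_sq_ne_zero (b : ℝ) :
    ∫⁻ θ : κ → ℝ, ENNReal.ofReal (Real.exp (-b * (θ ⬝ᵥ θ))) ≠ 0 := by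
  have hm : Measurable fun θ : κ → ℝ => ENNReal.ofReal (Real.exp (-b * (θ ⬝ᵥ θ))) := by
    unfold dotProduct
    fun_prop
  rw [Ne, lintegral_eq_zero_iff hm]
  intro h
  obtain ⟨θ, hθ⟩ := h.exists
  have := Real.exp_pos (-b * (θ ⬝ᵥ θ))
  simp only [Pi.zero_apply, ENNReal.ofReal_eq_zero] at hθ
  linarith

theorem lintegral_exp_neg_sq_ne_top {b : ℝ} (hb : 0 < b) :
    ∫⁻ θ : κ → ℝ, ENNReal.ofReal (Real.exp (-b * (θ ⬝ᵥ θ))) ≠ ⊤ := by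
  have h : Integrable (fun θ : κ → ℝ => ∏ i, Real.exp (-b * θ i ^ 2)) :=
    Integrable.fintype_prod fun _ => integrable_exp_neg_mul_sq hb
  have he : (fun θ : κ → ℝ => Real.exp (-b * (θ ⬝ᵥ θ))) = fun θ => ∏ i, Real.exp (-b * θ i ^ 2) := by
    funext θ
    rw [← Real.exp_sum, ← Finset.mul_sum]
    simp [dotProduct, pow_two]
  rw [← he] at h
  exact (hasFiniteIntegral_iff_ofReal (ae_of_all _ fun _ => (Real.exp_pos _).le)).1 h.2 |>.ne

variable [DecidableEq κ]

/-- A Gaussian integral in several variables, relative to a standard one. -/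
theorem lintegral_exp_quadratic {V : Matrix κ κ ℝ} (hV : V.PosDef) (s : κ → ℝ) {τ lam : ℝ}
    (hτ : 0 < τ) (hlam : 0 < lam) :
    ∫⁻ θ : κ → ℝ, ENNReal.ofReal (Real.exp (θ ⬝ᵥ s - τ / 2 * (θ ⬝ᵥ V *ᵥ θ))) =
      ENNReal.ofReal
          (√(lam ^ Fintype.card κ / V.det) * Real.exp (s ⬝ᵥ V⁻¹ *ᵥ s / (2 * τ))) *
        ∫⁻ θ : κ → ℝ, ENNReal.ofReal (Real.exp (-(τ * lam / 2) * (θ ⬝ᵥ θ))) := by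
  open scoped MatrixOrder in
  obtain ⟨R, hR⟩ := CStarAlgebra.nonneg_iff_eq_star_mul_self.mp hV.posSemidef.nonneg
  rw [star_eq_conjTranspose, conjTranspose_eq_transpose_of_trivial] at hR
  -- With V = RᵀR, the substitution u = Mθ turns the form θᵀVθ into lam u·u, and its Jacobian
  -- produces the determinant factor.
  set M : Matrix κ κ ℝ := (√lam)⁻¹ • R with hM
  have hdet : M.det ^ 2 = V.det / lam ^ Fintype.card κ := by
    rw [hM, det_smul, hR, det_mul, det_transpose, mul_pow, ← pow_mul, mul_comm _ 2, pow_mul,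
      inv_pow, Real.sq_sqrt hlam.le, inv_pow]
    field_simp
  have hdetpos : 0 < V.det / lam ^ Fintype.card κ := div_pos hV.det_pos (by positivity)
  have hdet0 : M.det ≠ 0 := fun h => by
    rw [h] at hdet
    norm_num at hdet
    exact hdetpos.ne hdet
  have hquad (θ : κ → ℝ) : (M *ᵥ θ) ⬝ᵥ (M *ᵥ θ) = lam⁻¹ * (θ ⬝ᵥ V *ᵥ θ) := by
    rw [hR, ← mulVec_mulVec, dotProduct_mulVec θ, vecMul_transpose, hM, smul_mulVec,
      smul_dotProduct, dotProduct_smul, smul_eq_mul, smul_eq_mul, ← mul_assoc, ← mul_inv,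
      Real.mul_self_sqrt hlam.le]
  -- Translation to the maximizer τ⁻¹V⁻¹s of the exponent completes the square.
  have hshift := lintegral_add_right_eq_self (μ := (volume : Measure (κ → ℝ)))
    (fun θ : κ → ℝ => ENNReal.ofReal (Real.exp (θ ⬝ᵥ s - τ / 2 * (θ ⬝ᵥ V *ᵥ θ))))
    (τ⁻¹ • V⁻¹ *ᵥ s)
  have hexp (θ : κ → ℝ) : (θ + τ⁻¹ • V⁻¹ *ᵥ s) ⬝ᵥ s -
      τ / 2 * ((θ + τ⁻¹ • V⁻¹ *ᵥ s) ⬝ᵥ V *ᵥ (θ + τ⁻¹ • V⁻¹ *ᵥ s)) =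
      s ⬝ᵥ V⁻¹ *ᵥ s / (2 * τ) + -(τ * lam / 2) * ((M *ᵥ θ) ⬝ᵥ (M *ᵥ θ)) := by
    have h1 : V *ᵥ (V⁻¹ *ᵥ s) = s := by rw [mulVec_mulVec, hV.mul_inv_self, one_mulVec]
    rw [hquad, mulVec_add, mulVec_smul, h1]
    simp only [dotProduct_add, add_dotProduct, smul_dotProduct, dotProduct_smul, smul_eq_mul]
    rw [hV.posSemidef.dotProduct_mulVec_comm (V⁻¹ *ᵥ s) θ, h1, dotProduct_comm (V⁻¹ *ᵥ s) s]
    field_simp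
    ring
  rw [← hshift]
  simp only [hexp, Real.exp_add]
  have hmeas : Measurable fun u : κ → ℝ =>
      ENNReal.ofReal (Real.exp (-(τ * lam / 2) * (u ⬝ᵥ u))) := by
    unfold dotProduct
    fun_prop
  have hlin : Measurable (toLin' M) := (LinearMap.continuous_on_pi _).measurable
  have hcv : ∫⁻ θ : κ → ℝ, ENNReal.ofReal (Real.exp (-(τ * lam / 2) * ((M *ᵥ θ) ⬝ᵥ (M *ᵥ θ)))) =
      ENNReal.ofReal √(lam ^ Fintype.card κ / V.det) *
        ∫⁻ θ : κ → ℝ, ENNReal.ofReal (Real.exp (-(τ * lam / 2) * (θ ⬝ᵥ θ))) := by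
    have h := lintegral_map (μ := (volume : Measure (κ → ℝ))) hmeas hlin
    simp only [toLin'_apply] at h
    rw [← h, Real.map_matrix_volume_pi_eq_smul_volume_pi hdet0, lintegral_smul_measure, smul_eq_mul]
    congr 2
    rw [← Real.sqrt_sq_eq_abs, inv_pow, hdet, inv_div]
  simp only [ENNReal.ofReal_mul (Real.exp_pos _).le]
  rw [lintegral_const_mul _ (by simpa only [toLin'_apply, Function.comp_def] using hmeas.comp hlin),
    hcv, ENNReal.ofReal_mul (Real.sqrt_nonneg _), ← mul_assoc, mul_comm (ENNReal.ofReal (Real.exp _))]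

end GaussianMixture

/-! ### Self-normalized noise bound by the method of mixtures -/

section SelfNormalized

open Matrix

/-- The regularized design matrix `lam I + ∑ ΦᵀΦ` of the first `n` experiments `d 0, d 1, …`. -/
noncomputable def precision {T ι κ : Type*} [Fintype ι] [Fintype κ] [DecidableEq κ] (lam : ℝ)
    (Φ : T → Matrix ι κ ℝ) (d : ℕ → T) (n : ℕ) : Matrix κ κ ℝ :=
  lam • 1 + ∑ k ∈ Finset.range n, (Φ (d k))ᵀ * Φ (d k)

/-- The accumulated noise `∑ Φᵀ e` of the first `n` experiments; experiment `k` has noise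
`e (k + 1)`. -/
noncomputable def noiseSum {T ι κ : Type*} [Fintype ι]
    (Φ : T → Matrix ι κ ℝ) (d : ℕ → T) (e : ℕ → ι → ℝ) (n : ℕ) : κ → ℝ :=
  ∑ k ∈ Finset.range n, (Φ (d k))ᵀ *ᵥ e (k + 1)

/-- The mixture supermartingale of the self-normalized process. -/
noncomputable def mixture {T ι κ : Type*} [Fintype ι] [Fintype κ] [DecidableEq κ] (lam σ : ℝ)
    (Φ : T → Matrix ι κ ℝ) (d : ℕ → T) (e : ℕ → ι → ℝ) (n : ℕ) : ℝ :=
  √(lam ^ Fintype.card κ / (precision lam Φ d n).det) *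
    Real.exp (noiseSum Φ d e n ⬝ᵥ (precision lam Φ d n)⁻¹ *ᵥ noiseSum Φ d e n / (2 * σ ^ 2))

theorem measurable_comp_of_countable {Ω T α : Type*} [Countable T] [MeasurableSpace α]
    {m : MeasurableSpace Ω} {D : Ω → T} (hD : ∀ t, MeasurableSet[m] {ω | D ω = t}) (f : T → α) :
    Measurable[m] fun ω => f (D ω) := by
  let : MeasurableSpace T := ⊤
  exact measurable_from_top.comp (measurable_to_countable' hD)

variable {T ι κ : Type*} [Fintype ι]

/-- All rows that enter `precision`, in one matrix. -/
def stackedRows (Φ : T → Matrix ι κ ℝ) (d : ℕ → T) (n : ℕ) : Matrix (Fin n × ι) κ ℝ :=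
  Matrix.of fun j => Φ (d j.1) j.2

theorem stackedRows_transpose_mul_self (Φ : T → Matrix ι κ ℝ) (d : ℕ → T) (n : ℕ) :
    (stackedRows Φ d n)ᵀ * stackedRows Φ d n =
      ∑ k ∈ Finset.range n, (Φ (d k))ᵀ * Φ (d k) := by
  ext a b
  rw [Matrix.sum_apply, Matrix.mul_apply, Fintype.sum_prod_type,
    Finset.sum_range fun k => ((Φ (d k))ᵀ * Φ (d k)) a b]
  rfl

theorem stackedRows_transpose_mulVec (Φ : T → Matrix ι κ ℝ) (d : ℕ → T) (n : ℕ)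
    (e : ℕ → ι → ℝ) :
    (stackedRows Φ d n)ᵀ *ᵥ (fun j => e j.1 j.2) =
      ∑ k ∈ Finset.range n, (Φ (d k))ᵀ *ᵥ e k := by
  ext a
  rw [Finset.sum_apply, Finset.sum_range fun k => ((Φ (d k))ᵀ *ᵥ e k) a]
  simp only [mulVec, dotProduct]
  rw [Fintype.sum_prod_type]
  rfl

variable [Fintype κ] [DecidableEq κ]

theorem precision_eq (lam : ℝ) (Φ : T → Matrix ι κ ℝ) (d : ℕ → T) (n : ℕ) :
    precision lam Φ d n = lam • 1 + (stackedRows Φ d n)ᵀ * stackedRows Φ d n := by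
  rw [stackedRows_transpose_mul_self, precision]

theorem precision_posDef {lam : ℝ} (hlam : 0 < lam) (Φ : T → Matrix ι κ ℝ) (d : ℕ → T) (n : ℕ) :
    (precision lam Φ d n).PosDef := by
  rw [precision_eq]
  exact posDef_smul_one_add_transpose_mul_self hlam _

theorem dotProduct_precision_mulVec (lam : ℝ) (Φ : T → Matrix ι κ ℝ) (d : ℕ → T) (n : ℕ)
    (θ : κ → ℝ) :
    θ ⬝ᵥ precision lam Φ d n *ᵥ θ =
      lam * (θ ⬝ᵥ θ) + ∑ k ∈ Finset.range n, (Φ (d k) *ᵥ θ) ⬝ᵥ (Φ (d k) *ᵥ θ) := by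
  rw [precision, add_mulVec, smul_mulVec, one_mulVec, dotProduct_add, dotProduct_smul, smul_eq_mul,
    sum_mulVec, dotProduct_sum]
  congr 1
  refine Finset.sum_congr rfl fun k _ => ?_
  rw [← mulVec_mulVec, dotProduct_mulVec θ, vecMul_transpose]

variable {Ω : Type*} [mΩ : MeasurableSpace Ω] {ℙ : Measure Ω} [IsProbabilityMeasure ℙ]
  {ℱ : Filtration ℕ mΩ} {σ : ℝ} {v : ℕ → ι → Ω → ℝ}

omit [Fintype κ] [DecidableEq κ] in
-- The sub-Gaussian condition says that the normalized exponential, taken as a density, does not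
-- increase the measure of any event of ℱ n. Comparing the trimmed measures then allows every
-- nonnegative ℱ n-measurable factor Z, with no integrability condition.
theorem SubGaussianNoise.lintegral_mul_exp_le (hv : SubGaussianNoise ℙ ℱ σ v) (n : ℕ)
    (r : ι → ℝ) {Z : Ω → ENNReal} (hZ : Measurable[ℱ n] Z) :
    ∫⁻ ω, Z ω * ENNReal.ofReal
      (Real.exp (∑ i, r i * v (n + 1) i ω - σ ^ 2 / 2 * ∑ i, r i ^ 2)) ∂ℙ ≤ ∫⁻ ω, Z ω ∂ℙ := by
  obtain ⟨hm, hr⟩ := hv n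
  obtain ⟨hint, hle⟩ := hr r
  have hvm : ∀ i, Measurable (v (n + 1) i) := fun i => (hm i).mono (ℱ.le _) le_rfl
  set c := Real.exp (-(σ ^ 2 / 2 * ∑ i, r i ^ 2)) with hc
  have hX (ω : Ω) : Real.exp (∑ i, r i * v (n + 1) i ω - σ ^ 2 / 2 * ∑ i, r i ^ 2) =
      c * Real.exp (∑ i, r i * v (n + 1) i ω) := by
    rw [hc, ← Real.exp_add]
    congr 1
    ring
  set X : Ω → ENNReal := fun ω => ENNReal.ofReal
    (Real.exp (∑ i, r i * v (n + 1) i ω - σ ^ 2 / 2 * ∑ i, r i ^ 2)) with hXdef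
  have hXm : Measurable X := by fun_prop
  have hmeas : (ℙ.withDensity X).trim (ℱ.le n) ≤ ℙ.trim (ℱ.le n) := by
    refine Measure.le_iff.2 fun s hs => ?_
    rw [trim_measurableSet_eq _ hs, trim_measurableSet_eq _ hs, withDensity_apply _ (ℱ.le n s hs)]
    simp only [hXdef, hX]
    rw [← ofReal_integral_eq_lintegral_ofReal (hint.integrableOn.const_mul c)
      (ae_of_all _ fun ω => by positivity), integral_const_mul, ← setIntegral_condExp (ℱ.le n) hint hs]
    have h1 : ∫ ω in s, (ℙ[fun ω => Real.exp (∑ i, r i * v (n + 1) i ω) | ℱ n]) ω ∂ℙ ≤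
        ∫ _ in s, Real.exp (σ ^ 2 / 2 * ∑ i, r i ^ 2) ∂ℙ :=
      setIntegral_mono_ae integrable_condExp.integrableOn (integrable_const _).integrableOn hle
    rw [setIntegral_const, smul_eq_mul] at h1
    rw [← ofReal_measureReal (measure_ne_top _ _)]
    refine ENNReal.ofReal_le_ofReal ?_
    calc _ ≤ c * (ℙ.real s * Real.exp (σ ^ 2 / 2 * ∑ i, r i ^ 2)) := by gcongr
      _ = ℙ.real s * Real.exp (-(σ ^ 2 / 2 * ∑ i, r i ^ 2) + σ ^ 2 / 2 * ∑ i, r i ^ 2) := by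
        rw [Real.exp_add, hc]; ring
      _ = ℙ.real s := by simp
  calc ∫⁻ ω, Z ω * X ω ∂ℙ = ∫⁻ ω, Z ω ∂(ℙ.withDensity X) := by
        rw [lintegral_withDensity_eq_lintegral_mul _ hXm (hZ.mono (ℱ.le n) le_rfl)]
        simp [mul_comm]
    _ = ∫⁻ ω, Z ω ∂((ℙ.withDensity X).trim (ℱ.le n)) := (lintegral_trim _ hZ).symm
    _ ≤ ∫⁻ ω, Z ω ∂(ℙ.trim (ℱ.le n)) := lintegral_mono' hmeas le_rfl
    _ = ∫⁻ ω, Z ω ∂ℙ := lintegral_trim _ hZ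

omit [Fintype κ] [DecidableEq κ] in
/-- The same with a predictable direction. -/
theorem SubGaussianNoise.lintegral_mul_exp_le_of_predictable [Countable T]
    (hv : SubGaussianNoise ℙ ℱ σ v) (n : ℕ) {D : Ω → T}
    (hD : ∀ t, MeasurableSet[ℱ n] {ω | D ω = t}) (r : T → ι → ℝ) {Z : Ω → ENNReal}
    (hZ : Measurable[ℱ n] Z) :
    ∫⁻ ω, Z ω * ENNReal.ofReal (Real.exp (∑ i, r (D ω) i * v (n + 1) i ω -
      σ ^ 2 / 2 * ∑ i, r (D ω) i ^ 2)) ∂ℙ ≤ ∫⁻ ω, Z ω ∂ℙ := by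
  have hU : (⋃ t, {ω | D ω = t}) = univ := by ext; simp
  have hdisj : Pairwise (Function.onFun Disjoint fun t => {ω | D ω = t}) := by
    intro t t' htt'
    refine Set.disjoint_left.2 fun ω h h' => htt' ?_
    rw [← show D ω = t from h, ← show D ω = t' from h']
  -- On each of the countably many pieces {D = t} the direction is constant.
  have hsplit (f : Ω → ENNReal) : ∫⁻ ω, f ω ∂ℙ = ∑' t, ∫⁻ ω in {ω | D ω = t}, f ω ∂ℙ := by
    rw [← lintegral_iUnion (fun t => ℱ.le n _ (hD t)) hdisj, hU, Measure.restrict_univ]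
  rw [hsplit, hsplit Z]
  refine ENNReal.tsum_le_tsum fun t => ?_
  have ht := ℱ.le n _ (hD t)
  rw [← lintegral_indicator ht, ← lintegral_indicator ht]
  refine (le_of_eq ?_).trans (hv.lintegral_mul_exp_le n (r t) (hZ.indicator (hD t)))
  refine lintegral_congr fun ω => ?_
  by_cases h : D ω = t
  · simp [indicator, h]
  · simp [indicator, h]

variable [Countable T]

omit [DecidableEq κ] in
-- For fixed θ this is an exponential supermartingale: each experiment contributes a factor with
-- direction Φθ, to which the sub-Gaussian bound applies.
theorem SubGaussianNoise.lintegral_exp_noiseSum_le (hv : SubGaussianNoise ℙ ℱ σ v)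
    (Φ : T → Matrix ι κ ℝ) {D : ℕ → Ω → T} (hD : ∀ n t, MeasurableSet[ℱ n] {ω | D n ω = t})
    (θ : κ → ℝ) (n : ℕ) :
    ∫⁻ ω, ENNReal.ofReal (Real.exp (
      θ ⬝ᵥ noiseSum Φ (fun k => D k ω) (fun k i => v k i ω) n - σ ^ 2 / 2 *
        ∑ k ∈ Finset.range n, (Φ (D k ω) *ᵥ θ) ⬝ᵥ (Φ (D k ω) *ᵥ θ))) ∂ℙ ≤ 1 := by
  induction n with
  | zero => simp [noiseSum]
  | succ n ih =>
    refine le_trans ?_ ih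
    refine le_trans (le_of_eq ?_) (hv.lintegral_mul_exp_le_of_predictable n (hD n)
      (fun t => Φ t *ᵥ θ) (Z := fun ω => ENNReal.ofReal (Real.exp (
      θ ⬝ᵥ noiseSum Φ (fun k => D k ω) (fun k i => v k i ω) n - σ ^ 2 / 2 *
        ∑ k ∈ Finset.range n, (Φ (D k ω) *ᵥ θ) ⬝ᵥ (Φ (D k ω) *ᵥ θ)))) ?_)
    · refine lintegral_congr fun ω => ?_
      rw [← ENNReal.ofReal_mul (Real.exp_pos _).le, ← Real.exp_add]
      congr 2
      simp only [noiseSum]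
      rw [Finset.sum_range_succ, Finset.sum_range_succ, dotProduct_add,
        dotProduct_mulVec θ, vecMul_transpose]
      simp only [dotProduct, pow_two]
      ring
    · refine ENNReal.measurable_ofReal.comp (Real.measurable_exp.comp (Measurable.sub ?_ ?_))
      · simp only [noiseSum, dotProduct_sum, dotProduct_mulVec θ, vecMul_transpose]
        refine Finset.measurable_sum _ fun k hk => ?_
        have hkn := Finset.mem_range.1 hk
        unfold dotProduct
        refine Finset.measurable_sum _ fun i _ => Measurable.mul ?_ ?_
        · exact (measurable_comp_of_countable (hD k) fun t => (Φ t *ᵥ θ) i).mono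
            (ℱ.mono hkn.le) le_rfl
        · exact ((hv k).1 i).mono (ℱ.mono hkn) le_rfl
      · refine Measurable.const_mul (Finset.measurable_sum _ fun k hk => ?_) _
        exact (measurable_comp_of_countable (hD k) fun t => (Φ t *ᵥ θ) ⬝ᵥ (Φ t *ᵥ θ)).mono
          (ℱ.mono (Finset.mem_range.1 hk).le) le_rfl

/-- Integrate the supermartingales over θ with the weight exp(-σ² lam/2 · θ·θ). The weight supplies
the regularization lam in `precision`, and Tonelli exchanges the integrals. The total weight C is
never computed: it cancels, being neither zero nor infinite. -/
theorem SubGaussianNoise.lintegral_mixture_le (hv : SubGaussianNoise ℙ ℱ σ v) (hσ : 0 < σ)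
    {lam : ℝ} (hlam : 0 < lam)
    (Φ : T → Matrix ι κ ℝ) {D : ℕ → Ω → T} (hD : ∀ n t, MeasurableSet[ℱ n] {ω | D n ω = t})
    (n : ℕ) :
    ∫⁻ ω, ENNReal.ofReal (mixture lam σ Φ (fun k => D k ω) (fun k i => v k i ω) n) ∂ℙ ≤ 1 := by
  set C := ∫⁻ θ : κ → ℝ, ENNReal.ofReal (Real.exp (-(σ ^ 2 * lam / 2) * (θ ⬝ᵥ θ))) with hC
  have hC0 : C ≠ 0 := lintegral_exp_neg_sq_ne_zero _
  have hCt : C ≠ ⊤ := lintegral_exp_neg_sq_ne_top (by positivity)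
  have hDm (k : ℕ) (i : ι) (a : κ) : Measurable fun ω => Φ (D k ω) i a :=
    (measurable_comp_of_countable (hD k) fun t => Φ t i a).mono (ℱ.le k) le_rfl
  have hvm (k : ℕ) (i : ι) : Measurable fun ω => v (k + 1) i ω := ((hv k).1 i).mono (ℱ.le _) le_rfl
  have hjoint : Measurable fun p : Ω × (κ → ℝ) => ENNReal.ofReal (Real.exp (
      p.2 ⬝ᵥ noiseSum Φ (fun k => D k p.1) (fun k i => v k i p.1) n -
        σ ^ 2 / 2 * (p.2 ⬝ᵥ precision lam Φ (fun k => D k p.1) n *ᵥ p.2))) := by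
    simp only [dotProduct_precision_mulVec]
    simp only [noiseSum, dotProduct, mulVec, Finset.sum_apply,
      transpose_apply]
    have h1 (k : ℕ) (i : ι) (a : κ) : Measurable fun p : Ω × (κ → ℝ) => Φ (D k p.1) i a :=
      (hDm k i a).comp measurable_fst
    have h2 (k : ℕ) (i : ι) : Measurable fun p : Ω × (κ → ℝ) => v (k + 1) i p.1 :=
      (hvm k i).comp measurable_fst
    have h3 (a : κ) : Measurable fun p : Ω × (κ → ℝ) => p.2 a :=
      (measurable_pi_apply a).comp measurable_snd
    have h4 (k : ℕ) (i : ι) : Measurable fun p : Ω × (κ → ℝ) => ∑ a, Φ (D k p.1) i a * p.2 a :=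
      Finset.measurable_sum _ fun a _ => (h1 k i a).mul (h3 a)
    refine ENNReal.measurable_ofReal.comp (Real.measurable_exp.comp (Measurable.sub
      (Finset.measurable_sum _ fun a _ => (h3 a).mul (Finset.measurable_sum _ fun k _ =>
        Finset.measurable_sum _ fun i _ => (h1 k i a).mul (h2 k i)))
      (Measurable.const_mul (Measurable.add
        (Measurable.const_mul (Finset.measurable_sum _ fun a _ => (h3 a).mul (h3 a)) _)
        (Finset.measurable_sum _ fun k _ => Finset.measurable_sum _ fun i _ =>
          (h4 k i).mul (h4 k i))) _)))
  have h : (∫⁻ ω, ENNReal.ofReal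
      (mixture lam σ Φ (fun k => D k ω) (fun k i => v k i ω) n) ∂ℙ) * C ≤ C := by
    calc _ ≤ ∫⁻ ω, ENNReal.ofReal
          (mixture lam σ Φ (fun k => D k ω) (fun k i => v k i ω) n) * C ∂ℙ :=
        lintegral_mul_const_le _ _
      _ = ∫⁻ ω, (∫⁻ θ : κ → ℝ, ENNReal.ofReal (Real.exp (
          θ ⬝ᵥ noiseSum Φ (fun k => D k ω) (fun k i => v k i ω) n -
            σ ^ 2 / 2 * (θ ⬝ᵥ precision lam Φ (fun k => D k ω) n *ᵥ θ)))) ∂ℙ := by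
        refine lintegral_congr fun ω => ?_
        rw [lintegral_exp_quadratic (precision_posDef hlam Φ _ n) _ (by positivity : 0 < σ ^ 2) hlam]
        rfl
      _ = ∫⁻ θ : κ → ℝ, (∫⁻ ω, ENNReal.ofReal (Real.exp (
          θ ⬝ᵥ noiseSum Φ (fun k => D k ω) (fun k i => v k i ω) n -
            σ ^ 2 / 2 * (θ ⬝ᵥ precision lam Φ (fun k => D k ω) n *ᵥ θ))) ∂ℙ) :=
        lintegral_lintegral_swap hjoint.aemeasurable
      _ ≤ C := by
        rw [hC]
        refine lintegral_mono fun θ => ?_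
        have hθ := hv.lintegral_exp_noiseSum_le Φ hD θ n
        calc _ = ∫⁻ ω, ENNReal.ofReal (Real.exp (-(σ ^ 2 * lam / 2) * (θ ⬝ᵥ θ))) *
              ENNReal.ofReal (Real.exp (
              θ ⬝ᵥ noiseSum Φ (fun k => D k ω) (fun k i => v k i ω) n - σ ^ 2 / 2 *
                ∑ k ∈ Finset.range n, (Φ (D k ω) *ᵥ θ) ⬝ᵥ (Φ (D k ω) *ᵥ θ))) ∂ℙ := by
              refine lintegral_congr fun ω => ?_
              rw [← ENNReal.ofReal_mul (Real.exp_pos _).le, ← Real.exp_add,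
                dotProduct_precision_mulVec]
              congr 2
              ring
          _ ≤ _ := by
            rw [lintegral_const_mul' _ _ ENNReal.ofReal_ne_top]
            exact mul_le_of_le_one_right zero_le hθ
  rwa [← ENNReal.mul_le_mul_iff_left hC0 hCt, one_mul]

omit [Fintype ι] [Countable T] mΩ in
-- Prefixes of length n have only countably many values, so F itself needs no measurability.
theorem measurable_of_prefix [Countable T] {m : MeasurableSpace Ω} {α : Type*} [MeasurableSpace α]
    (t₀ : T) {D : ℕ → Ω → T} {n : ℕ} (hD : ∀ k < n, ∀ t, MeasurableSet[m] {ω | D k ω = t})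
    {F : (ℕ → T) → α} (hF : ∀ d d', (∀ k < n, d k = d' k) → F d = F d') :
    Measurable[m] fun ω => F fun k => D k ω := by
  have h := measurable_comp_of_countable (m := m) (D := fun ω (k : Fin n) => D k ω) (fun f => ?_)
    fun f => F fun k => if hk : k < n then f ⟨k, hk⟩ else t₀
  · convert h using 2 with ω
    exact hF _ _ fun k hk => by simp [hk]
  · have : {ω | (fun k : Fin n => D k ω) = f} = ⋂ k : Fin n, {ω | D k ω = f k} := by
      ext ω
      simp [funext_iff]
    rw [this]
    exact MeasurableSet.iInter fun k => hD k k.2 _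

omit [Countable T] in
theorem precision_congr (lam : ℝ) (Φ : T → Matrix ι κ ℝ) {d d' : ℕ → T} {n : ℕ}
    (h : ∀ k < n, d k = d' k) : precision lam Φ d n = precision lam Φ d' n := by
  unfold precision
  congr 1
  exact Finset.sum_congr rfl fun k hk => by rw [h k (Finset.mem_range.1 hk)]

theorem measurable_mixture (hv : ∀ n i, Measurable[ℱ (n + 1)] (v (n + 1) i)) (t₀ : T) (lam : ℝ)
    (Φ : T → Matrix ι κ ℝ) {D : ℕ → Ω → T} (hD : ∀ n t, MeasurableSet[ℱ n] {ω | D n ω = t})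
    (n : ℕ) :
    Measurable[ℱ n] fun ω => mixture lam σ Φ (fun k => D k ω) (fun k i => v k i ω) n := by
  have hDn : ∀ k < n, ∀ t, MeasurableSet[ℱ n] {ω | D k ω = t} := fun k hk t =>
    ℱ.mono hk.le _ (hD k t)
  have hs (a : κ) : Measurable[ℱ n]
      fun ω => noiseSum Φ (fun k => D k ω) (fun k i => v k i ω) n a := by
    simp only [noiseSum, Finset.sum_apply, mulVec, dotProduct, transpose_apply]
    refine Finset.measurable_sum _ fun k hk => Finset.measurable_sum _ fun i _ => ?_
    have hk := Finset.mem_range.1 hk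
    exact (measurable_comp_of_countable (hDn k hk) fun t => Φ t i a).mul
      ((hv k i).mono (ℱ.mono hk) le_rfl)
  have hV (a b : κ) : Measurable[ℱ n] fun ω => (precision lam Φ (fun k => D k ω) n)⁻¹ a b :=
    measurable_of_prefix t₀ hDn (F := fun d => (precision lam Φ d n)⁻¹ a b) fun d d' h => by
      rw [precision_congr lam Φ h]
  have hdet : Measurable[ℱ n]
      fun ω => √(lam ^ Fintype.card κ / (precision lam Φ (fun k => D k ω) n).det) :=
    measurable_of_prefix t₀ hDn
      (F := fun d => √(lam ^ Fintype.card κ / (precision lam Φ d n).det)) fun d d' h => by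
        rw [precision_congr lam Φ h]
  unfold mixture
  refine hdet.mul (Real.measurable_exp.comp (Measurable.div_const ?_ _))
  simp only [dotProduct, mulVec]
  exact Finset.measurable_sum _ fun a _ => (hs a).mul
    (Finset.measurable_sum _ fun b _ => (hV a b).mul (hs b))

omit [Countable T] in
-- Experiments with zero features contribute nothing, so switching to t₀ freezes the mixture.
-- Stopping thus stays within the predictable sequences of experiments.
theorem mixture_eq_of_stopped (lam : ℝ) (Φ : T → Matrix ι κ ℝ) {t₀ : T} (ht₀ : Φ t₀ = 0)
    {d d' : ℕ → T} (e : ℕ → ι → ℝ) {m n : ℕ} (hmn : m ≤ n) (h : ∀ k < m, d' k = d k)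
    (h' : ∀ k, m ≤ k → d' k = t₀) : mixture lam σ Φ d' e n = mixture lam σ Φ d e m := by
  have hsub : Finset.range m ⊆ Finset.range n := Finset.range_subset_range.2 hmn
  have hV : precision lam Φ d' n = precision lam Φ d m := by
    unfold precision
    congr 1
    rw [← Finset.sum_subset hsub fun k _ hk => ?_]
    · exact Finset.sum_congr rfl fun k hk => by rw [h k (Finset.mem_range.1 hk)]
    · rw [h' k (by simpa using hk), ht₀]
      simp
  have hs : noiseSum Φ d' e n = noiseSum Φ d e m := by
    unfold noiseSum
    rw [← Finset.sum_subset hsub fun k _ hk => ?_]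
    · exact Finset.sum_congr rfl fun k hk => by rw [h k (Finset.mem_range.1 hk)]
    · rw [h' k (by simpa using hk), ht₀]
      simp
  rw [mixture, mixture, hV, hs]

/-- A time-uniform bound for the self-normalized process. -/
theorem SubGaussianNoise.measure_exists_mixture_gt_le (hv : SubGaussianNoise ℙ ℱ σ v) (hσ : 0 < σ)
    {lam : ℝ} (hlam : 0 < lam) (Φ : T → Matrix ι κ ℝ) {t₀ : T} (ht₀ : Φ t₀ = 0)
    {D : ℕ → Ω → T} (hD : ∀ n t, MeasurableSet[ℱ n] {ω | D n ω = t}) {δ : ℝ} (hδ : 0 < δ) :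
    ℙ {ω | ∃ n, 1 / δ < mixture lam σ Φ (fun k => D k ω) (fun k i => v k i ω) n} ≤
      ENNReal.ofReal δ := by
  classical
  set Y : ℕ → Ω → ℝ := fun n ω => mixture lam σ Φ (fun k => D k ω) (fun k i => v k i ω) n with hY
  have hYm (n : ℕ) : Measurable[ℱ n] (Y n) :=
    measurable_mixture (fun n => (hv n).1) t₀ lam Φ hD n
  have hbound (N : ℕ) : ℙ {ω | ∃ n ≤ N, 1 / δ < Y n ω} ≤ ENNReal.ofReal δ := by
    -- The experiments are stopped once the mixture exceeds 1/δ. The stopped mixture at the horizon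
    -- N keeps the excessive value, so Markov's inequality at the single time N bounds the
    -- probability of an excess up to N.
    set D' : ℕ → Ω → T := fun k ω => if ∀ j ≤ k, Y j ω ≤ 1 / δ then D k ω else t₀ with hD'def
    have hD' : ∀ n t, MeasurableSet[ℱ n] {ω | D' n ω = t} := by
      intro n t
      have h1 : MeasurableSet[ℱ n] {ω | ∀ j ≤ n, Y j ω ≤ 1 / δ} := by
        simp only [ofPred_forall]
        exact MeasurableSet.iInter fun j => MeasurableSet.iInter fun hj =>
          ((hYm j).mono (ℱ.mono hj) le_rfl) measurableSet_Iic
      have h2 : {ω | D' n ω = t} = ({ω | ∀ j ≤ n, Y j ω ≤ 1 / δ} ∩ {ω | D n ω = t}) ∪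
          ({ω | ∀ j ≤ n, Y j ω ≤ 1 / δ}ᶜ ∩ {_ω | t₀ = t}) := by
        ext ω
        by_cases h : ∀ j ≤ n, Y j ω ≤ 1 / δ
        · simp only [hD'def, mem_ofPred_eq, if_pos h, mem_union, mem_inter_iff, mem_compl_iff]
          tauto
        · simp only [hD'def, mem_ofPred_eq, if_neg h, mem_union, mem_inter_iff, mem_compl_iff]
          tauto
      rw [h2]
      exact (h1.inter (hD n t)).union (h1.compl.inter (MeasurableSet.const _))
    have hle := hv.lintegral_mixture_le hσ hlam Φ hD' N
    set Y' : Ω → ℝ := fun ω => mixture lam σ Φ (fun k => D' k ω) (fun k i => v k i ω) N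
    have hY'm : Measurable Y' :=
      (measurable_mixture (fun n => (hv n).1) t₀ lam Φ hD' N).mono (ℱ.le N) le_rfl
    have hsub : {ω | ∃ n ≤ N, 1 / δ < Y n ω} ⊆
        {ω | ENNReal.ofReal (1 / δ) ≤ ENNReal.ofReal (Y' ω)} := by
      rintro ω ⟨n, hn, hlt⟩
      have hex : ∃ n, 1 / δ < Y n ω := ⟨n, hlt⟩
      have hfind := Nat.find_spec hex
      refine ENNReal.ofReal_le_ofReal (hfind.le.trans (le_of_eq ?_))
      refine (mixture_eq_of_stopped lam Φ ht₀ _ ((Nat.find_min' hex hlt).trans hn) ?_ ?_).symm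
      · intro k hk
        exact if_pos fun j hj => not_lt.1 (Nat.find_min hex (hj.trans_lt hk))
      · intro k hk
        exact if_neg fun h => (h _ hk).not_gt hfind
    have hmarkov := mul_meas_ge_le_lintegral (μ := ℙ) hY'm.ennreal_ofReal (ENNReal.ofReal (1 / δ))
    have h3 : ENNReal.ofReal (1 / δ) * ℙ {ω | ∃ n ≤ N, 1 / δ < Y n ω} ≤ 1 :=
      (mul_le_mul_right (measure_mono hsub) _).trans (hmarkov.trans hle)
    calc ℙ {ω | ∃ n ≤ N, 1 / δ < Y n ω}
        = ENNReal.ofReal δ * (ENNReal.ofReal (1 / δ) * ℙ {ω | ∃ n ≤ N, 1 / δ < Y n ω}) := by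
          rw [← mul_assoc, ← ENNReal.ofReal_mul hδ.le, mul_one_div_cancel hδ.ne',
            ENNReal.ofReal_one, one_mul]
      _ ≤ ENNReal.ofReal δ * 1 := by gcongr
      _ = ENNReal.ofReal δ := mul_one _
  have hU : {ω | ∃ n, 1 / δ < Y n ω} = ⋃ N, {ω | ∃ n ≤ N, 1 / δ < Y n ω} := by
    ext ω
    simp only [mem_ofPred_eq, mem_iUnion]
    exact ⟨fun ⟨n, h⟩ => ⟨n, n, le_rfl, h⟩, fun ⟨_, n, _, h⟩ => ⟨n, h⟩⟩
  have hmono : Monotone fun N => {ω | ∃ n ≤ N, 1 / δ < Y n ω} :=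
    fun N N' hN ω ⟨n, hn, h⟩ => ⟨n, hn.trans hN, h⟩
  rw [hU, hmono.measure_iUnion]
  exact iSup_le hbound

end SelfNormalized

/-! ### Finite-dimensional features of a kernel -/

section Features

open Matrix

/-- Parseval's identity; only one of the two vectors has to lie in W. -/
theorem sum_inner_mul_inner_of_mem {H : Type*} [NormedAddCommGroup H] [InnerProductSpace ℝ H]
    {W : Submodule ℝ H} {n : ℕ} (b : OrthonormalBasis (Fin n) ℝ W) {x : H} (hx : x ∈ W) (y : H) :
    ∑ a, inner ℝ (b a : H) x * inner ℝ (b a : H) y = inner ℝ x y := by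
  have h := congrArg (Subtype.val) (b.sum_repr' ⟨x, hx⟩)
  simp only [Submodule.coe_sum, Submodule.coe_smul, Submodule.coe_inner] at h
  conv_rhs => rw [← h]
  rw [sum_inner]
  simp [real_inner_smul_left]

/-- A kernel on a finite set is given by finitely many features, in which each element of the RKHS
is linear with a coefficient vector of no larger norm. -/
theorem RKHS.exists_features {Z : Type*} [Finite Z] {H : Type*} [NormedAddCommGroup H]
    [InnerProductSpace ℝ H] [CompleteSpace H] [RKHS ℝ H Z ℝ] (φ : H) :
    ∃ (N : ℕ) (ψ : Z → Fin N → ℝ) (w : Fin N → ℝ),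
      (∀ ζ ζ', RKHS.kernel H ζ ζ' 1 = ψ ζ ⬝ᵥ ψ ζ') ∧ (∀ ζ, φ ζ = ψ ζ ⬝ᵥ w) ∧ √(w ⬝ᵥ w) ≤ ‖φ‖ := by
  -- Evaluations are inner products with kernel functions, so they only see the projection of φ to
  -- their span. Its coordinates are the weights w, and Bessel's inequality bounds their norm.
  set W : Submodule ℝ H := Submodule.span ℝ (range fun ζ : Z => RKHS.kerFun H ζ (1 : ℝ)) with hW
  have : FiniteDimensional ℝ W := FiniteDimensional.span_of_finite ℝ (finite_range _)
  set b := stdOrthonormalBasis ℝ W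
  have hmem (ζ : Z) : RKHS.kerFun H ζ (1 : ℝ) ∈ W := Submodule.subset_span ⟨ζ, rfl⟩
  refine ⟨_, fun ζ a => inner ℝ (b a : H) (RKHS.kerFun H ζ (1 : ℝ)), fun a => inner ℝ (b a : H) φ,
    fun ζ ζ' => ?_, fun ζ => ?_, ?_⟩
  · rw [dotProduct, sum_inner_mul_inner_of_mem b (hmem ζ), RKHS.kerFun_inner, RKHS.kerFun_apply]
    simp
  · rw [dotProduct, sum_inner_mul_inner_of_mem b (hmem ζ), RKHS.kerFun_inner]
    simp
  · have hb : Orthonormal ℝ fun a => (b a : H) := b.orthonormal.comp_linearIsometry W.subtypeₗᵢ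
    have h := hb.sum_inner_products_le φ (s := Finset.univ)
    refine (Real.sqrt_le_sqrt ?_).trans_eq (Real.sqrt_sq (norm_nonneg φ))
    simpa [dotProduct, pow_two] using h

end Features

/-! ### The Gaussian process posterior as ridge regression, and its confidence intervals -/

namespace GoSafe

open Matrix

variable {P E U : Type*} [NormedAddCommGroup P] [NormedAddCommGroup E] [NormedSpace ℝ E]
  {ℓ q : ℕ} (c : GoSafe P E U ℓ q)

/-- The features of the observations from an experiment, if one was completed. -/
def rows {N : ℕ} (ψ : c.Input → Fin N → ℝ) (d : Option c.Pair) : Matrix (Fin (q + 1)) (Fin N) ℝ :=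
  d.elim 0 fun p => Matrix.of fun i => ψ (p, i)

/-- The data from the first `n` experiments, where `d k` is the pair with which experiment `k` was
completed (`none` if it was not), and `e (k + 1)` is its noise. -/
noncomputable def recorded (d : ℕ → Option c.Pair) (e : ℕ → Fin (q + 1) → ℝ) : ℕ → c.Data
  | 0 => []
  | n + 1 => match d n with
    | none => recorded d e n
    | some p => recorded d e n ++ [(p, fun i => c.h p i + e (n + 1) i)]

variable {c}

section Posterior

variable {N : ℕ} {ψ : c.Input → Fin N → ℝ}

/-- The features of all observations. -/
def Data.design (ψ : c.Input → Fin N → ℝ) (L : c.Data) :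
    Matrix (Fin L.length × Fin (q + 1)) (Fin N) ℝ :=
  Matrix.of fun j => ψ (L.input j)

theorem Data.design_transpose_mul_self (L : c.Data) :
    (L.design ψ)ᵀ * L.design ψ =
      (L.map fun p => (c.rows ψ (some p.1))ᵀ * c.rows ψ (some p.1)).sum := by
  rw [← Fin.sum_univ_fun_getElem]
  ext a b
  rw [Matrix.sum_apply, Matrix.mul_apply, Fintype.sum_prod_type]
  rfl

theorem Data.design_transpose_mulVec_obs (L : c.Data) :
    (L.design ψ)ᵀ *ᵥ L.obs = (L.map fun p => (c.rows ψ (some p.1))ᵀ *ᵥ p.2).sum := by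
  rw [← Fin.sum_univ_fun_getElem]
  ext a
  rw [Finset.sum_apply]
  simp only [mulVec, dotProduct]
  rw [Fintype.sum_prod_type]
  rfl

variable (hψ : ∀ ζ ζ', c.k ζ ζ' = ψ ζ ⬝ᵥ ψ ζ')
include hψ

theorem gram_eq (L : c.Data) : c.gram L = L.design ψ * (L.design ψ)ᵀ + c.lam • 1 := by
  rw [gram]
  congr 1
  ext j j'
  rw [of_apply, hψ, mul_apply]
  rfl

theorem kvec_eq (L : c.Data) (ζ : c.Input) : c.kvec L ζ = L.design ψ *ᵥ ψ ζ := by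
  ext j
  rw [kvec, hψ, dotProduct_comm]
  rfl

theorem postMean_eq (hlam : 0 < c.lam) (L : c.Data) (ζ : c.Input) :
    c.postMean L ζ = ψ ζ ⬝ᵥ (c.lam • (1 : Matrix (Fin N) (Fin N) ℝ) +
      (L.map fun p => (c.rows ψ (some p.1))ᵀ * c.rows ψ (some p.1)).sum)⁻¹ *ᵥ
        (L.map fun p => (c.rows ψ (some p.1))ᵀ *ᵥ p.2).sum := by
  rw [postMean, kvec_eq hψ, gram_eq hψ, mulVec_dotProduct_inv_gram _ hlam,
    Data.design_transpose_mul_self, Data.design_transpose_mulVec_obs]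

theorem postStd_eq (hlam : 0 < c.lam) (L : c.Data) (ζ : c.Input) :
    c.postStd L ζ = √(c.lam * (ψ ζ ⬝ᵥ (c.lam • (1 : Matrix (Fin N) (Fin N) ℝ) +
      (L.map fun p => (c.rows ψ (some p.1))ᵀ * c.rows ψ (some p.1)).sum)⁻¹ *ᵥ ψ ζ)) := by
  rw [postStd, kvec_eq hψ, gram_eq hψ, hψ, dotProduct_sub_dotProduct_inv_gram _ hlam,
    Data.design_transpose_mul_self]

end Posterior

section Recorded

variable {N : ℕ} {ψ : c.Input → Fin N → ℝ} (d : ℕ → Option c.Pair) (e : ℕ → Fin (q + 1) → ℝ)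

@[simp] theorem rows_none : c.rows ψ none = 0 := rfl

theorem precision_recorded (n : ℕ) :
    c.lam • (1 : Matrix (Fin N) (Fin N) ℝ) +
      ((c.recorded d e n).map fun p => (c.rows ψ (some p.1))ᵀ * c.rows ψ (some p.1)).sum =
      precision c.lam (c.rows ψ) d n := by
  rw [precision]
  congr 1
  induction n with
  | zero => simp [recorded]
  | succ n ih =>
    rw [recorded, Finset.sum_range_succ, ← ih]
    cases d n <;> simp

/-- The part of the observations that the linear model does not explain. -/
noncomputable def excess (φ : c.Input → ℝ) (d : Option c.Pair) (i : Fin (q + 1)) : ℝ :=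
  d.elim 0 fun p => c.h p i - φ (p, i)

/-- Each observation is a linear part, noise, and the excess h - φ. The excess accommodates a reward
outside the RKHS. -/
theorem response_recorded {φ : c.Input → ℝ} {w : Fin N → ℝ} (hφ : ∀ ζ, φ ζ = ψ ζ ⬝ᵥ w) (n : ℕ) :
    ((c.recorded d e n).map fun p => (c.rows ψ (some p.1))ᵀ *ᵥ p.2).sum =
      ((stackedRows (c.rows ψ) d n)ᵀ * stackedRows (c.rows ψ) d n) *ᵥ w +
        noiseSum (c.rows ψ) d e n +
        (stackedRows (c.rows ψ) d n)ᵀ *ᵥ (fun j => excess φ (d j.1) j.2) := by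
  rw [stackedRows_transpose_mul_self,
    stackedRows_transpose_mulVec (c.rows ψ) d n fun k => excess φ (d k)]
  induction n with
  | zero => simp [recorded, noiseSum]
  | succ n ih =>
    have hs : noiseSum (c.rows ψ) d e (n + 1) =
        noiseSum (c.rows ψ) d e n + (c.rows ψ (d n))ᵀ *ᵥ e (n + 1) := by
      rw [noiseSum, Finset.sum_range_succ, ← noiseSum]
    rw [recorded, Finset.sum_range_succ, Finset.sum_range_succ, hs, add_mulVec]
    cases d n with
    | none => simpa using ih
    | some p =>
      have hy : (fun i => c.h p i + e (n + 1) i) =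
          c.rows ψ (some p) *ᵥ w + e (n + 1) + excess φ (some p) := by
        ext i
        have h1 : (c.rows ψ (some p) *ᵥ w) i = φ (p, i) := (hφ (p, i)).symm
        simp only [Pi.add_apply, h1, excess, Option.elim]
        ring
      simp only [List.map_append, List.map_cons, List.map_nil, List.sum_append, List.sum_cons,
        List.sum_nil, add_zero, hy, ih, mulVec_add, mulVec_mulVec]
      abel

/-- By Sylvester's identity det(1 + lam⁻¹K) is det V / lam^N, where V is the precision of the
observed inputs. -/
theorem log_det_precision_le [Nonempty c.Pair] (hψ : ∀ ζ ζ', c.k ζ ζ' = ψ ζ ⬝ᵥ ψ ζ')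
    (hlam : 0 < c.lam) (n : ℕ) :
    1 / 2 * Real.log ((precision c.lam (c.rows ψ) d n).det / c.lam ^ N) ≤
      c.infoCapacity (n * (q + 1)) := by
  classical
  obtain ⟨p₀⟩ := ‹Nonempty c.Pair›
  -- The capacity refers to exactly n(q + 1) inputs, but some experiments give no data. They are
  -- filled up with an arbitrary pair p₀, which can only increase the determinant; d'' consists of
  -- these additions.
  set d' : ℕ → Option c.Pair := fun k => some ((d k).getD p₀) with hd'
  set d'' : ℕ → Option c.Pair := fun k => if d k = none then some p₀ else none with hd''
  have hsum : precision c.lam (c.rows ψ) d' n = precision c.lam (c.rows ψ) d n +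
      (stackedRows (c.rows ψ) d'' n)ᵀ * stackedRows (c.rows ψ) d'' n := by
    rw [stackedRows_transpose_mul_self, precision, precision, add_assoc, ← Finset.sum_add_distrib]
    congr 1
    refine Finset.sum_congr rfl fun k _ => ?_
    cases h : d k <;> simp [hd', hd'', h]
  have hdet := det_le_det_add_transpose_mul_self (precision_posDef hlam (c.rows ψ) d n)
    (stackedRows (c.rows ψ) d'' n)
  rw [← hsum] at hdet
  have hpos := (precision_posDef hlam (c.rows ψ) d n).det_pos
  set p : Fin (n * (q + 1)) → c.Input :=
    fun j => ((d (finProdFinEquiv.symm j).1).getD p₀, (finProdFinEquiv.symm j).2) with hp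
  have hK : (1 + c.lam⁻¹ • Matrix.of fun j j' => c.k (p j) (p j')).det =
      (precision c.lam (c.rows ψ) d' n).det / c.lam ^ N := by
    set A := stackedRows (c.rows ψ) d' n with hA
    have h1 : (1 + c.lam⁻¹ • Matrix.of fun j j' => c.k (p j) (p j')) =
        (1 + (c.lam⁻¹ • A) * Aᵀ).submatrix finProdFinEquiv.symm finProdFinEquiv.symm := by
      change _ = (1 : Matrix (Fin n × Fin (q + 1)) (Fin n × Fin (q + 1)) ℝ).submatrix
        finProdFinEquiv.symm finProdFinEquiv.symm + ((c.lam⁻¹ • A) * Aᵀ).submatrix _ _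
      rw [submatrix_one_equiv]
      congr 1
      ext j j'
      rw [submatrix_apply, smul_mul, Matrix.smul_apply, Matrix.smul_apply, of_apply, hψ, mul_apply]
      rfl
    have h2 : precision c.lam (c.rows ψ) d' n = c.lam • (1 + Aᵀ * (c.lam⁻¹ • A)) := by
      rw [precision_eq, smul_add, Matrix.mul_smul, smul_smul, mul_inv_cancel₀ hlam.ne', one_smul]
    rw [h1, det_submatrix_equiv_self, det_one_add_mul_comm, h2, det_smul, Fintype.card_fin,
      mul_div_cancel_left₀ _ (pow_pos hlam N).ne']
  calc _ ≤ 1 / 2 * Real.log ((precision c.lam (c.rows ψ) d' n).det / c.lam ^ N) := by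
        gcongr
    _ = 1 / 2 * Real.log (1 + c.lam⁻¹ • Matrix.of fun j j' => c.k (p j) (p j')).det := by rw [hK]
    _ ≤ c.infoCapacity (n * (q + 1)) :=
      le_ciSup (f := fun p : Fin (n * (q + 1)) → c.Input =>
        1 / 2 * Real.log (1 + c.lam⁻¹ • Matrix.of fun j j' => c.k (p j) (p j')).det)
        (Set.finite_range _).bddAbove p

/-- Taking logarithms bounds Q/(2σ²) by the capacity plus log(1/δ); the summand 1 is slack. -/
theorem noiseSum_le_of_mixture_le [Nonempty c.Pair] (hψ : ∀ ζ ζ', c.k ζ ζ' = ψ ζ ⬝ᵥ ψ ζ')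
    (hlam : 0 < c.lam) {σ δ : ℝ} (hσ : 0 < σ) {n : ℕ}
    (hmix : mixture c.lam σ (c.rows ψ) d e n ≤ 1 / δ) :
    √(noiseSum (c.rows ψ) d e n ⬝ᵥ (precision c.lam (c.rows ψ) d n)⁻¹ *ᵥ
      noiseSum (c.rows ψ) d e n) ≤
      σ * √(2 * (c.infoCapacity (n * (q + 1)) + 1 + Real.log (1 / δ))) := by
  have hγ := log_det_precision_le d hψ hlam n
  rw [mixture, Fintype.card_fin] at hmix
  have hpos := (precision_posDef hlam (c.rows ψ) d n).det_pos
  have hratio : 0 < c.lam ^ N / (precision c.lam (c.rows ψ) d n).det :=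
    div_pos (pow_pos hlam N) hpos
  have hlog := Real.log_le_log (by positivity) hmix
  rw [Real.log_mul (Real.sqrt_pos.2 hratio).ne' (Real.exp_pos _).ne', Real.log_exp,
    Real.log_sqrt hratio.le, ← inv_div (precision c.lam (c.rows ψ) d n).det, Real.log_inv] at hlog
  rw [← Real.sqrt_sq hσ.le, ← Real.sqrt_mul (sq_nonneg σ)]
  refine Real.sqrt_le_sqrt ?_
  set Q := noiseSum (c.rows ψ) d e n ⬝ᵥ (precision c.lam (c.rows ψ) d n)⁻¹ *ᵥ
    noiseSum (c.rows ψ) d e n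
  have h2 : Q / (2 * σ ^ 2) ≤ c.infoCapacity (n * (q + 1)) + 1 + Real.log (1 / δ) := by linarith
  rw [div_le_iff₀ (by positivity)] at h2
  linarith

/-- The confidence intervals contain the constraint functions as long as the mixture is bounded. -/
theorem abs_h_sub_postMean_le [Nonempty c.Pair] (hψ : ∀ ζ ζ', c.k ζ ζ' = ψ ζ ⬝ᵥ ψ ζ')
    (hlam : 0 < c.lam) {φ : c.Input → ℝ} {w : Fin N → ℝ} (hφw : ∀ ζ, φ ζ = ψ ζ ⬝ᵥ w) {B : ℝ}
    (hB : √(w ⬝ᵥ w) ≤ B) (hφ : ∀ d (i : Fin q), φ (d, i.succ) = c.h d i.succ)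
    (hφ0 : (∀ d, φ (d, 0) = c.h d 0) ∨ ∀ d d' (i : Fin q), c.k (d, 0) (d', i.succ) = 0)
    {σ δ : ℝ} (hσ : 0 < σ) {n : ℕ}
    (hmix : mixture c.lam σ (c.rows ψ) d e n ≤ 1 / δ)
    (hβ : B + σ / √c.lam * √(2 * (c.infoCapacity (n * (q + 1)) + 1 + Real.log (1 / δ))) ≤
      √(c.β (n + 1))) (p : c.Pair) (i : Fin q) :
    |c.h p i.succ - c.postMean (c.recorded d e n) (p, i.succ)| ≤
      √(c.β (n + 1)) * c.postStd (c.recorded d e n) (p, i.succ) := by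
  have hnoise := noiseSum_le_of_mixture_le d e hψ hlam hσ hmix
  rw [← hφ, hφw, postMean_eq hψ hlam, postStd_eq hψ hlam, precision_recorded,
    response_recorded d e hφw]
  rw [precision_eq] at hnoise ⊢
  -- Constraint rows have no excess. Reward rows have none if φ also matches the reward; otherwise
  -- their features are orthogonal to those of the constraints, so the excess does not reach the
  -- prediction of a constraint.
  have hexcess : ψ (p, i.succ) ⬝ᵥ (c.lam • (1 : Matrix (Fin N) (Fin N) ℝ) +
      (stackedRows (c.rows ψ) d n)ᵀ * stackedRows (c.rows ψ) d n)⁻¹ *ᵥ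
      ((stackedRows (c.rows ψ) d n)ᵀ *ᵥ fun j => excess φ (d j.1) j.2) = 0 := by
    have hsucc (d : Option c.Pair) (i : Fin q) : excess φ d i.succ = 0 := by
      cases d with
      | none => rfl
      | some p => exact sub_eq_zero.2 (hφ p i).symm
    rcases hφ0 with h0 | h0
    · have hz : (fun j : Fin n × Fin (q + 1) => excess φ (d j.1) j.2) = 0 := by
        ext ⟨k, i⟩
        refine Fin.cases ?_ (fun i => hsucc _ i) i
        change excess φ (d k) 0 = 0
        cases d k with
        | none => rfl
        | some p => exact sub_eq_zero.2 (h0 p).symm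
      rw [hz]
      simp
    · have horth (o : Option c.Pair) (p' : c.Pair) (i' : Fin q) :
          c.rows ψ o 0 ⬝ᵥ ψ (p', i'.succ) = 0 := by
        cases o with
        | none => exact zero_dotProduct _
        | some p => exact (hψ (p, 0) (p', i'.succ)).symm.trans (h0 p p' i')
      refine dotProduct_inv_eq_zero_of_orthogonal hlam _ {j | j.2 = 0} ?_ _ ?_ _ ?_
      · rintro ⟨k, i⟩ hi ⟨k', i'⟩ hi'
        obtain rfl : i = 0 := hi
        obtain ⟨i'', rfl⟩ := Fin.exists_succ_eq.2 (show i' ≠ 0 from hi')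
        change c.rows ψ (d k) 0 ⬝ᵥ c.rows ψ (d k') i''.succ = 0
        cases d k' with
        | none => exact dotProduct_zero _
        | some p' => exact horth _ p' i''
      · rintro ⟨k, i'⟩ hi
        obtain rfl : i' = 0 := hi
        exact horth _ _ _
      · rintro ⟨k, i'⟩ hi
        obtain ⟨i'', rfl⟩ := Fin.exists_succ_eq.2 (show i' ≠ 0 from hi)
        exact hsucc _ _
  refine (abs_dotProduct_sub_ridge_le _ hlam _ _ _ _ hB hexcess).trans ?_
  rw [mul_comm]
  gcongr
  refine le_trans ?_ hβ
  gcongr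
  rw [div_mul_eq_mul_div]
  gcongr

end Recorded

end GoSafe

/-! ### Deterministic safety of runs -/

namespace GoSafe

variable {P E U : Type*} [NormedAddCommGroup P] [NormedAddCommGroup E] [NormedSpace ℝ E]
  {ℓ q : ℕ} {c : GoSafe P E U ℓ q}

/-! ### Dynamics -/

/-- A grid point has distance 0 to itself, so it is its only closest grid point. -/
theorem quant_coe (hXμ : ∀ y ∈ c.Xμ, y ∈ c.X)
    (hquant : ∀ x ∈ c.X, ‖x - c.quant x‖ ≤ c.μ ∧ ∀ y ∈ c.Xμ, c.l1dist x (c.quant x) ≤ c.l1dist x y)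
    (y : c.Xμ) : c.quant (y : E) = y := by
  have h := (hquant y (hXμ y y.2)).2 y y.2
  have h0 : c.l1dist (y : E) y = 0 := by simp [l1dist]
  have h1 : ∑ j, |c.coord.repr (y : E) j - c.coord.repr (c.quant (y : E) : E) j| = 0 :=
    le_antisymm (h.trans_eq h0) (Finset.sum_nonneg fun _ _ => abs_nonneg _)
  rw [Finset.sum_eq_zero_iff_of_nonneg fun _ _ => abs_nonneg _] at h1
  refine Subtype.ext (c.coord.repr.injective (Finsupp.ext fun j => ?_))
  exact (sub_eq_zero.1 (abs_eq_zero.1 (h1 j (Finset.mem_univ j)))).symm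

theorem IsTrajectory.continuousOn {a : P} {x₁ : E} {x : ℝ → E} (hx : c.IsTrajectory a x₁ x) :
    ContinuousOn x (Ici 0) := fun t ht => (hx.2 t ht).2.continuousWithinAt

theorem IsTrajectory.g_le {a : P} {x₁ : E} {x : ℝ → E} (hx : c.IsTrajectory a x₁ x) {i : Fin q}
    (hb : BddBelow (c.constraintValues i a x₁)) {t : ℝ} (ht : 0 ≤ t) :
    c.g i a x₁ ≤ c.gbar i (x t) := csInf_le hb ⟨x, hx, t, ht, rfl⟩

theorem hitTimes_congr (S : Set c.Pair) {x y : ℝ → E} (h : EqOn x y (Ici 0)) :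
    c.hitTimes S x = c.hitTimes S y := by
  ext t
  refine and_congr_right fun ht => ?_
  rw [h ht]

theorem safeStates_mono {S S' : Set c.Pair} (h : S ⊆ S') : c.safeStates S ⊆ c.safeStates S' :=
  fun _ ⟨a, ha⟩ => ⟨a, h ha⟩

theorem mem_border_of_subset {S S' : Set c.Pair} (h : S ⊆ S') {y : c.Xμ}
    (hy : y ∈ c.safeStates S) (hy' : y ∈ c.border S') : y ∈ c.border S := by
  obtain ⟨_, x, hx, hxy, hq⟩ := hy'
  exact ⟨hy, x, hx, hxy, fun h' => hq (safeStates_mono h h')⟩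

/-- A trajectory cannot leave the region of safe quantized states without its quantization meeting
the border. -/
theorem quant_mem_safeStates (hμ : 0 < c.μ)
    (hquant : ∀ x ∈ c.X, ‖x - c.quant x‖ ≤ c.μ ∧ ∀ y ∈ c.Xμ, c.l1dist x (c.quant x) ≤ c.l1dist x y)
    {S : Set c.Pair} {a : P} {x₁ : E} {x : ℝ → E} (hx : c.IsTrajectory a x₁ x)
    (h0 : c.quant x₁ ∈ c.safeStates S) {s : ℝ} (hs : 0 ≤ s)
    (hhit : ∀ t ∈ Icc 0 s, t ∉ c.hitTimes S x) : c.quant (x s) ∈ c.safeStates S := by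
  by_contra hbad
  set bad : Set ℝ := {t | t ∈ Icc 0 s ∧ c.quant (x t) ∉ c.safeStates S} with hbaddef
  have hne : bad.Nonempty := ⟨s, ⟨hs, le_rfl⟩, hbad⟩
  have hbdd : BddBelow bad := ⟨0, fun t ht => ht.1.1⟩
  set T := sInf bad with hT
  have hT0 : 0 ≤ T := le_csInf hne fun t ht => ht.1.1
  have hTs : T ≤ s := csInf_le hbdd ⟨⟨hs, le_rfl⟩, hbad⟩
  obtain ⟨η, hη, hcont⟩ := Metric.continuousWithinAt_iff.1 (hx.continuousOn T hT0) c.μ hμ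
  -- A good state x t within μ of a bad state x t' has a quantization within 2μ of x t', hence on
  -- the border.
  have key {t t' : ℝ} (ht : t ∈ Icc 0 s) (ht' : 0 ≤ t') (hd : ‖x t - x t'‖ < c.μ)
      (hg : c.quant (x t) ∈ c.safeStates S) (hb : c.quant (x t') ∉ c.safeStates S) : False := by
    refine hhit t ht ⟨ht.1, hg, x t', (hx.2 t' ht').1, ?_, hb⟩
    have h1 := (hquant (x t) (hx.2 t ht.1).1).1
    rw [norm_sub_rev] at h1
    calc ‖(c.quant (x t) : E) - x t'‖ ≤ ‖(c.quant (x t) : E) - x t‖ + ‖x t - x t'‖ :=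
          norm_sub_le_norm_sub_add_norm_sub _ _ _
      _ < 2 * c.μ := by linarith
  -- T is the infimum of the bad times. If T is good, there are bad times shortly after it; if T is
  -- bad, it is positive, and all earlier times are good.
  by_cases hTbad : c.quant (x T) ∈ c.safeStates S
  · obtain ⟨t, ht, htη⟩ := exists_lt_of_csInf_lt hne (show sInf bad < T + η by linarith)
    have htT : T ≤ t := csInf_le hbdd ht
    have hd := hcont (x := t) ht.1.1 (by rw [Real.dist_eq, abs_of_nonneg] <;> linarith)
    rw [dist_comm, dist_eq_norm] at hd
    exact key ⟨hT0, hTs⟩ ht.1.1 hd hTbad ht.2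
  · have hTpos : 0 < T := by
      refine lt_of_le_of_ne hT0 fun h => hTbad ?_
      rw [← h, hx.1]
      exact h0
    set t := max 0 (T - η / 2) with ht
    have htT : t < T := max_lt hTpos (by linarith)
    have ht0 : 0 ≤ t := le_max_left _ _
    have htη : T - η / 2 ≤ t := le_max_right _ _
    have hd := hcont (x := t) ht0 (by rw [Real.dist_eq, abs_lt]; constructor <;> linarith)
    rw [dist_eq_norm] at hd
    have hgood : c.quant (x t) ∈ c.safeStates S := by
      by_contra h
      exact htT.not_ge (csInf_le hbdd ⟨⟨ht0, htT.le.trans hTs⟩, h⟩)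
    exact key ⟨ht0, htT.le.trans hTs⟩ hT0 hd hgood hTbad

/-! ### Safe sets -/

variable (c) in
/-- The standing assumptions on the system and its quantization. -/
structure IsRegular : Prop where
  mu_pos : 0 < c.μ
  mem_X : ∀ y ∈ c.Xμ, y ∈ c.X
  quant : ∀ x ∈ c.X, ‖x - c.quant x‖ ≤ c.μ ∧ ∀ y ∈ c.Xμ, c.l1dist x (c.quant x) ≤ c.l1dist x y
  traj : ∀ a ∈ c.A, ∀ x₁ ∈ c.X, (∃ x, c.IsTrajectory a x₁ x) ∧
    ∀ x x', c.IsTrajectory a x₁ x → c.IsTrajectory a x₁ x' → Set.EqOn x x' (Set.Ici 0)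
  bdd : ∀ i, ∀ a ∈ c.A, ∀ x₁ ∈ c.X, BddBelow (c.constraintValues i a x₁)
  Lx_nonneg : 0 ≤ c.Lx
  lip : ∀ i, ∀ a ∈ c.A, ∀ a' ∈ c.A, ∀ x₁ ∈ c.X, ∀ x₁' ∈ c.X,
    |c.g i a x₁ - c.g i a' x₁'| ≤ c.La * ‖a - a'‖ + c.Lx * ‖x₁ - x₁'‖

variable (c) in
/-- All pairs in `S` satisfy the constraints, and there is a margin for quantization errors for all
pairs that can serve as a backup, and for some pair with any given safe initial condition. -/
structure IsSafeSet (S : Set c.Pair) : Prop where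
  g_nonneg : ∀ d ∈ S, ∀ i, 0 ≤ c.g i d.1 d.2
  backup : ∀ d ∈ S, d.2 ∈ c.border S → ∀ i, c.Lx * c.μ ≤ c.g i d.1 d.2
  exists_margin : ∀ y ∈ c.safeStates S, ∃ a, (a, y) ∈ S ∧ ∀ i, c.Lx * c.μ ≤ c.g i a y

theorem IsRegular.g_nonneg_of_near (hc : c.IsRegular) {a : c.A} {y : c.Xμ} {i : Fin q}
    (hg : c.Lx * c.μ ≤ c.g i a y) {x : E} (hx : x ∈ c.X) (hxy : ‖x - y‖ ≤ c.μ) :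
    0 ≤ c.g i a x := by
  have h := (abs_le.1 (hc.lip i a a.2 a a.2 x hx y (hc.mem_X y y.2))).1
  rw [sub_self, norm_zero, mul_zero, zero_add] at h
  have := mul_le_mul_of_nonneg_left hxy hc.Lx_nonneg
  linarith

/-- No backup is run here: since g is an infimum that includes time 0, the mere existence of
parameters that are safe from x gives the bound at x. -/
theorem IsRegular.gbar_nonneg_of_quant_mem (hc : c.IsRegular) {S : Set c.Pair}
    (hS : c.IsSafeSet S) {x : E} (hx : x ∈ c.X) (hq : c.quant x ∈ c.safeStates S) (i : Fin q) :
    0 ≤ c.gbar i x := by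
  obtain ⟨a, -, ha⟩ := hS.exists_margin _ hq
  obtain ⟨y, hy⟩ := (hc.traj a a.2 x hx).1
  have h := hy.g_le (hc.bdd i a a.2 x hx) le_rfl
  rw [hy.1] at h
  exact (hc.g_nonneg_of_near (ha i) hx (hc.quant x hx).1).trans h

theorem IsRegular.gbar_nonneg_of_not_hit (hc : c.IsRegular) {S : Set c.Pair}
    (hS : c.IsSafeSet S) {d : c.Pair} (hd : d.2 ∈ c.safeStates S) {x : ℝ → E}
    (hx : c.IsTrajectory d.1 d.2 x) {s : ℝ} (hs : 0 ≤ s)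
    (hhit : ∀ t ∈ Icc 0 s, t ∉ c.hitTimes S x) (i : Fin q) : 0 ≤ c.gbar i (x s) :=
  hc.gbar_nonneg_of_quant_mem hS (hx.2 s hs).1 (quant_mem_safeStates hc.mu_pos hc.quant hx
    (by rwa [quant_coe hc.mem_X hc.quant]) hs hhit) i

/-- The quantization may jump at τ, but the trajectory is continuous, so the distance bound at times
shortly after τ passes to the limit. -/
theorem IsRegular.norm_sub_trigger_le (hc : c.IsRegular) {S : Set c.Pair} {a : P} {x₁ : E}
    {y : ℝ → E} (hy : c.IsTrajectory a x₁ y) {τ : ℝ} (hτ : 0 ≤ τ) {b : c.Xμ}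
    (hb : c.Triggers S y τ b) : ‖y τ - b‖ ≤ c.μ := by
  rcases hb.2 with ⟨-, h⟩ | ⟨-, h⟩
  · rw [← h]
    exact (hc.quant _ (hy.2 τ hτ).1).1
  · have hcont : Tendsto (fun t => ‖y t - b‖) (𝓝[>] τ) (𝓝 ‖y τ - b‖) := by
      have h1 : ContinuousWithinAt y (Ioi τ) τ :=
        (hy.continuousOn τ hτ).mono fun t ht => hτ.trans (le_of_lt ht)
      exact (h1.tendsto.sub_const _).norm
    by_contra! hlt
    refine h ?_
    filter_upwards [hcont.eventually (lt_mem_nhds hlt), self_mem_nhdsWithin] with t ht htτ hq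
    have := (hc.quant _ (hy.2 t (hτ.trans (le_of_lt htτ))).1).1
    rw [hq] at this
    exact this.not_gt ht

theorem IsRegular.rollout_safe (hc : c.IsRegular) {S : Set c.Pair} (hS : c.IsSafeSet S)
    {d : c.Pair} (hd : d.2 ∈ c.safeStates S) {x : ℝ → E} {trigger : Option c.Xμ}
    (hx : c.IsRollout S d x trigger) {t : ℝ} (ht : 0 ≤ t) (i : Fin q) : 0 ≤ c.gbar i (x t) := by
  cases trigger with
  | none =>
    obtain ⟨htraj, hhit⟩ := hx
    by_cases hdS : d ∈ S
    · exact (hS.g_nonneg d hdS i).trans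
        (htraj.g_le (hc.bdd i _ d.1.2 _ (hc.mem_X _ d.2.2)) ht)
    · refine hc.gbar_nonneg_of_not_hit hS hd htraj ht (fun s _ => ?_) i
      rw [hhit hdS]
      exact notMem_empty s
  | some b =>
    obtain ⟨-, y, τ, hy, hne, hglb, htrig, hxy, a', ha', y', hy', hxy'⟩ := hx
    have hτ : 0 ≤ τ := hglb.2 fun s hs => hs.1
    rcases lt_or_ge t τ with htτ | htτ
    · rw [hxy t ⟨ht, htτ.le⟩]
      exact hc.gbar_nonneg_of_not_hit hS hd hy ht
        (fun s hs h => (hs.2.trans_lt htτ).not_ge (hglb.1 h)) i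
    · have h := hxy' (t - τ) (sub_nonneg.2 htτ)
      rw [add_sub_cancel] at h
      rw [h]
      have hyX := (hy.2 τ hτ).1
      exact (hc.g_nonneg_of_near (hS.backup _ ha' htrig.1 i) hyX
        (hc.norm_sub_trigger_le hy hτ htrig)).trans
        (hy'.g_le (hc.bdd i _ a'.2 _ hyX) (sub_nonneg.2 htτ))

/-- The new pair starts at a known safe state, so safe states and border do not change. It comes
without reserve, but it cannot start on the border, since 0 would be a hitting time. -/
theorem IsRegular.isSafeSet_union_singleton (hc : c.IsRegular) {S : Set c.Pair}
    (hS : c.IsSafeSet S) {d : c.Pair} (hd : d.2 ∈ c.safeStates S) (hdS : d ∉ S) {x : ℝ → E}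
    (hx : c.Completes S d x) : c.IsSafeSet (S ∪ {d}) := by
  obtain ⟨htraj, hhit⟩ := hx
  replace hhit := hhit hdS
  have hsafe : c.safeStates (S ∪ {d}) = c.safeStates S := by
    refine Subset.antisymm ?_ (safeStates_mono subset_union_left)
    rintro y ⟨a, ha | ha⟩
    · exact ⟨a, ha⟩
    · obtain rfl : (a, y) = d := ha
      exact hd
  have hborder : c.border (S ∪ {d}) = c.border S := by rw [border, border, hsafe]
  refine ⟨?_, ?_, ?_⟩
  · rintro d' (hd' | hd') i
    · exact hS.g_nonneg d' hd' i
    · obtain rfl : d' = d := hd'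
      refine le_csInf ⟨_, x, htraj, 0, le_rfl, rfl⟩ ?_
      rintro r ⟨x', hx', t, ht, rfl⟩
      rw [(hc.traj _ d'.1.2 _ (hc.mem_X _ d'.2.2)).2 x' x hx' htraj ht]
      refine hc.gbar_nonneg_of_not_hit hS hd htraj ht (fun s _ => ?_) i
      rw [hhit]
      exact notMem_empty s
  · rw [hborder]
    rintro d' (hd' | hd') hb
    · exact hS.backup d' hd' hb
    · obtain rfl : d' = d := hd'
      have h0 : (0 : ℝ) ∈ c.hitTimes S x := by
        refine ⟨le_rfl, ?_⟩
        rwa [htraj.1, quant_coe hc.mem_X hc.quant]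
      rw [hhit] at h0
      exact absurd h0 (notMem_empty _)
  · rw [hsafe]
    intro y hy
    obtain ⟨a, ha, hg⟩ := hS.exists_margin y hy
    exact ⟨a, Or.inl ha, hg⟩

/-- The margin contains the term Lx μ, so certified pairs inherit the full reserve from Lipschitz
continuity. -/
theorem IsRegular.isSafeSet_localUpdate (hc : c.IsRegular) {S : Set c.Pair}
    (hS : c.IsSafeSet S) {l : c.Pair → Fin (q + 1) → EReal}
    (hl : ∀ d (i : Fin q), l d i.succ ≤ (c.g i d.1 d.2 : ℝ)) : c.IsSafeSet (c.localUpdate l S) := by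
  have hnew (d' : c.Pair) (h : ∀ i : Fin q, ∃ d ∈ S, (c.margin d d' : EReal) ≤ l d i.succ)
      (i : Fin q) : c.Lx * c.μ ≤ c.g i d'.1 d'.2 := by
    obtain ⟨d, -, hd⟩ := h i
    have h1 : c.margin d d' ≤ c.g i d.1 d.2 := EReal.coe_le_coe_iff.1 (hd.trans (hl d i))
    have h2 := (abs_le.1 (hc.lip i d.1 d.1.2 d'.1 d'.1.2 d.2 (hc.mem_X _ d.2.2) d'.2
      (hc.mem_X _ d'.2.2))).2
    unfold margin at h1
    linarith
  have hLμ : 0 ≤ c.Lx * c.μ := mul_nonneg hc.Lx_nonneg hc.mu_pos.le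
  refine ⟨?_, ?_, ?_⟩
  · rintro d (hd | hd) i
    · exact hLμ.trans (hnew d hd i)
    · exact hS.g_nonneg d hd i
  · rintro d (hd | hd) hb
    · exact hnew d hd
    -- Enlarging S creates new border states only among new safe states, so an old pair on the new
    -- border was on the old one.
    · exact hS.backup d hd (mem_border_of_subset subset_union_right ⟨d.1, hd⟩ hb)
  · rintro y ⟨a, ha | ha⟩
    · exact ⟨a, Or.inl ha, hnew _ ha⟩
    · obtain ⟨a', ha', hg⟩ := hS.exists_margin y ⟨a, ha⟩
      exact ⟨a', Or.inr ha', hg⟩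

/-! ### Runs -/

/-- The kind of update can be read off from membership in the safe set. Hence the stage conditions,
and with them the upper ends u, need not be shown measurable. -/
theorem State.IsQuery.mem_iff {s : c.State} {d : c.Pair} (h : s.IsQuery d) :
    d ∈ s.S ↔ ¬ s.global := by
  rcases h with ⟨h1, h2, -⟩ | ⟨h1, h2, h3, -⟩ | ⟨h1, h2, -⟩
  · exact iff_of_true (h2.1.elim (fun h => h.1) fun h => h.1) fun h => h.1 h1
  · exact iff_of_true h3.1 fun h => h.2 h2
  · exact iff_of_false h2.1 fun h => h h1

theorem State.IsQuery.mem_safeStates {s : c.State} {d : c.Pair} (h : s.IsQuery d) :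
    d.2 ∈ c.safeStates s.S := by
  by_cases hd : d ∈ s.S
  · exact ⟨d.1, hd⟩
  · rcases h with ⟨-, h2, -⟩ | ⟨-, -, h3, -⟩ | ⟨-, h2, -⟩
    · exact absurd (h2.1.elim (fun h => h.1) fun h => h.1) hd
    · exact absurd h3.1 hd
    · exact h2.2.2

/-- The pair with which the experiment of iteration `n + 1` was completed, if it was. -/
def completed (query : ℕ → Option c.Pair) (trigger : ℕ → Option c.Xμ) (n : ℕ) : Option c.Pair :=
  (trigger (n + 1)).elim (query (n + 1)) fun _ => none

theorem completed_eq_some {query : ℕ → Option c.Pair} {trigger : ℕ → Option c.Xμ} {n : ℕ}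
    {d : c.Pair} :
    completed query trigger n = some d ↔ query (n + 1) = some d ∧ trigger (n + 1) = none := by
  unfold completed
  cases trigger (n + 1) <;> simp

namespace IsRun

variable {v : ℕ → Fin (q + 1) → ℝ} {state : ℕ → c.State} {query : ℕ → Option c.Pair}
  {x : ℕ → ℝ → E} {trigger : ℕ → Option c.Xμ} (hrun : c.IsRun v state query x trigger)
include hrun

theorem data_eq (n : ℕ) : (state n).data = c.recorded (completed query trigger) v n := by
  induction n with
  | zero => rw [hrun.start]; rfl
  | succ n ih =>
    rw [recorded, ← ih]
    cases hq : query (n + 1) with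
    | none =>
      have : completed query trigger n = none := by
        unfold completed
        cases trigger (n + 1) <;> simp [hq]
      rw [this, (hrun.halt n hq).2]
    | some d =>
      rw [(hrun.step n d hq).2.2]
      cases ht : trigger (n + 1) with
      | none =>
        rw [completed_eq_some.2 ⟨hq, ht⟩]
        rfl
      | some b =>
        have : completed query trigger n = none := by simp [completed, ht]
        rw [this]
        rfl

theorem l_succ_of_query {n : ℕ} {d : c.Pair} (hq : query (n + 1) = some d) (p : c.Pair)
    (i : Fin (q + 1)) : (state (n + 1)).l p i =
      max ((state n).l p i) ((c.postMean (state n).data (p, i) -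
        √(c.β (n + 1)) * c.postStd (state n).data (p, i) : ℝ) : EReal) := by
  rw [(hrun.step n d hq).2.2]
  rfl

theorem S_succ_of_completed_global {n : ℕ} {d : c.Pair}
    (h : completed query trigger n = some d) (hd : d ∉ (state n).S) :
    (state (n + 1)).S = (state n).S ∪ {d} := by
  obtain ⟨hq, ht⟩ := completed_eq_some.1 h
  obtain ⟨hquery, -, hstep⟩ := hrun.step n d hq
  rw [hstep, ht]
  exact if_pos (not_not.1 fun h => hd (hquery.mem_iff.2 h))

theorem S_succ_of_completed_local {n : ℕ} {d : c.Pair}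
    (h : completed query trigger n = some d) (hd : d ∈ (state n).S) :
    (state (n + 1)).S = c.localUpdate (state (n + 1)).l (state n).S := by
  obtain ⟨hq, ht⟩ := completed_eq_some.1 h
  obtain ⟨hquery, -, hstep⟩ := hrun.step n d hq
  rw [hstep, ht]
  exact if_neg (hquery.mem_iff.1 hd)

theorem S_succ_of_not_completed {n : ℕ} (h : completed query trigger n = none) :
    (state (n + 1)).S = (state n).S := by
  cases hq : query (n + 1) with
  | none => rw [(hrun.halt n hq).2]
  | some d =>
    cases ht : trigger (n + 1) with
    | none =>
      rw [completed_eq_some.2 ⟨hq, ht⟩] at h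
      exact absurd h (Option.some_ne_none d)
    | some b =>
      rw [(hrun.step n d hq).2.2, ht]
      rfl

theorem mem_S_succ_iff {n : ℕ} {d' : c.Pair} :
    d' ∈ (state (n + 1)).S ↔ d' ∈ (state n).S ∨ ∃ d, completed query trigger n = some d ∧
      ((d ∉ (state n).S ∧ d' = d) ∨ (d ∈ (state n).S ∧ ∀ i : Fin q, ∃ p ∈ (state n).S,
        (c.margin p d' : EReal) ≤ (state (n + 1)).l p i.succ)) := by
  cases h : completed query trigger n with
  | none => simp [hrun.S_succ_of_not_completed h]
  | some d =>
    by_cases hd : d ∈ (state n).S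
    · rw [hrun.S_succ_of_completed_local h hd, localUpdate, or_comm]
      simp [hd]
    · rw [hrun.S_succ_of_completed_global h hd]
      simp [hd, or_comm]

variable (hc : c.IsRegular)
include hc

/-- Whether an experiment is completed is determined by the safe set and the pair. -/
theorem completed_eq_some_iff {n : ℕ} {d : c.Pair} :
    completed query trigger n = some d ↔ query (n + 1) = some d ∧
      (d ∈ (state n).S ∨ ∀ y, c.IsTrajectory d.1 d.2 y → c.hitTimes (state n).S y = ∅) := by
  rw [completed_eq_some]
  refine and_congr_right fun hq => ?_
  have hroll := (hrun.step n d hq).2.1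
  cases ht : trigger (n + 1) with
  | none =>
    rw [ht] at hroll
    obtain ⟨htraj, hhit⟩ := hroll
    refine iff_of_true rfl (or_iff_not_imp_left.2 fun hd y hy => ?_)
    rw [← hhit hd]
    exact hitTimes_congr _ ((hc.traj _ d.1.2 _ (hc.mem_X _ d.2.2)).2 y _ hy htraj)
  | some b =>
    rw [ht] at hroll
    obtain ⟨hd, y, τ, hy, hne, -⟩ := hroll
    refine iff_of_false (Option.some_ne_none b) ?_
    rintro (h | h)
    · exact hd h
    · exact hne.ne_empty (h y hy)

/-- If the confidence intervals contain the constraint functions, a run is safe. -/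
theorem isSafeSet (hS₀safe : ∀ d ∈ c.S₀, ∀ i, c.Lx * c.μ ≤ c.g i d.1 d.2)
    (hconf : ∀ n p (i : Fin q), |c.h p i.succ - c.postMean (state n).data (p, i.succ)| ≤
      √(c.β (n + 1)) * c.postStd (state n).data (p, i.succ)) (n : ℕ) :
    (∀ d (i : Fin q), (state n).l d i.succ ≤ (c.g i d.1 d.2 : ℝ)) ∧ c.IsSafeSet (state n).S := by
  induction n with
  | zero =>
    rw [hrun.start]
    refine ⟨fun d i => ?_, fun d hd i => ?_, fun d hd _ => hS₀safe d hd, ?_⟩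
    · simp only [init]
      split_ifs with h
      · exact EReal.coe_le_coe_iff.2 (hS₀safe d h.1 i)
      · exact bot_le
    · exact (mul_nonneg hc.Lx_nonneg hc.mu_pos.le).trans (hS₀safe d hd i)
    · rintro y ⟨a, ha⟩
      exact ⟨a, ha, hS₀safe _ ha⟩
  | succ n ih =>
    obtain ⟨ihl, ihS⟩ := ih
    have hl : ∀ d (i : Fin q), (state (n + 1)).l d i.succ ≤ (c.g i d.1 d.2 : ℝ) := by
      intro d i
      cases hq : query (n + 1) with
      | none =>
        rw [(hrun.halt n hq).2]
        exact ihl d i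
      | some d' =>
        rw [hrun.l_succ_of_query hq]
        refine max_le (ihl d i) (EReal.coe_le_coe_iff.2 ?_)
        have h1 := (abs_le.1 (hconf n d i)).1
        have h2 : c.h d i.succ = c.g i d.1 d.2 := rfl
        linarith
    refine ⟨hl, ?_⟩
    cases h : completed query trigger n with
    | none =>
      rw [hrun.S_succ_of_not_completed h]
      exact ihS
    | some d =>
      by_cases hd : d ∈ (state n).S
      · rw [hrun.S_succ_of_completed_local h hd]
        exact hc.isSafeSet_localUpdate ihS hl
      · rw [hrun.S_succ_of_completed_global h hd]
        obtain ⟨hq, ht⟩ := completed_eq_some.1 h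
        obtain ⟨hquery, hroll, -⟩ := hrun.step n d hq
        rw [ht] at hroll
        exact hc.isSafeSet_union_singleton ihS hquery.mem_safeStates hd hroll

theorem gbar_nonneg (hS₀safe : ∀ d ∈ c.S₀, ∀ i, c.Lx * c.μ ≤ c.g i d.1 d.2)
    (hconf : ∀ n p (i : Fin q), |c.h p i.succ - c.postMean (state n).data (p, i.succ)| ≤
      √(c.β (n + 1)) * c.postStd (state n).data (p, i.succ)) {n : ℕ} {d : c.Pair}
    (hq : query (n + 1) = some d) {t : ℝ} (ht : 0 ≤ t) (i : Fin q) :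
    0 ≤ c.gbar i (x (n + 1) t) := by
  obtain ⟨hquery, hroll, -⟩ := hrun.step n d hq
  exact hc.rollout_safe (hrun.isSafeSet hc hS₀safe hconf n).2 hquery.mem_safeStates hroll ht i

end IsRun

end GoSafe

/-! ### Measurability: the completed experiments are predictable -/

namespace GoSafe

open Matrix

variable {P E U : Type*} [NormedAddCommGroup P] [NormedAddCommGroup E] [NormedSpace ℝ E]
  {ℓ q : ℕ} {c : GoSafe P E U ℓ q}

section Posterior

variable {N : ℕ} {ψ : c.Input → Fin N → ℝ} (hψ : ∀ ζ ζ', c.k ζ ζ' = ψ ζ ⬝ᵥ ψ ζ')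
  (hlam : 0 < c.lam) {Ω : Type*} {m : MeasurableSpace Ω} {D : ℕ → Ω → Option c.Pair}
  {v : ℕ → Fin (q + 1) → Ω → ℝ} {n : ℕ}
  (hD : ∀ k < n, ∀ t, MeasurableSet[m] {ω | D k ω = t})
include hψ hlam hD

theorem measurable_postStd_recorded (ζ : c.Input) :
    Measurable[m] fun ω => c.postStd (c.recorded (fun k => D k ω) (fun k i => v k i ω) n) ζ := by
  simp only [postStd_eq hψ hlam, precision_recorded]
  exact measurable_of_prefix none hD
    (F := fun d => √(c.lam * (ψ ζ ⬝ᵥ (precision c.lam (c.rows ψ) d n)⁻¹ *ᵥ ψ ζ)))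
    fun d d' h => by rw [precision_congr c.lam (c.rows ψ) h]

theorem measurable_postMean_recorded (hv : ∀ k < n, ∀ i, Measurable[m] (v (k + 1) i))
    (ζ : c.Input) :
    Measurable[m] fun ω => c.postMean (c.recorded (fun k => D k ω) (fun k i => v k i ω) n) ζ := by
  -- With φ = 0 and w = 0 the excess is h itself, so the response is noise plus a function of the
  -- pairs.
  have hresp (d : ℕ → Option c.Pair) (e : ℕ → Fin (q + 1) → ℝ) :=
    response_recorded (ψ := ψ) d e (φ := 0) (w := 0) (fun ζ => by simp) n
  simp only [postMean_eq hψ hlam, precision_recorded, hresp, mulVec_zero, zero_add, mulVec_add,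
    dotProduct_add]
  refine Measurable.add ?_ ?_
  · simp only [dotProduct_mulVec, noiseSum, dotProduct_sum, vecMul_transpose]
    refine Finset.measurable_sum _ fun k hk => ?_
    have hk := Finset.mem_range.1 hk
    unfold dotProduct
    refine Finset.measurable_sum _ fun i _ => Measurable.mul ?_ (hv k hk i)
    exact measurable_of_prefix none hD
      (F := fun d => (c.rows ψ (d k) *ᵥ (ψ ζ ᵥ* (precision c.lam (c.rows ψ) d n)⁻¹)) i)
      fun d d' h => by rw [precision_congr c.lam (c.rows ψ) h, h k hk]
  · refine measurable_of_prefix none hD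
      (F := fun d => ψ ζ ⬝ᵥ (precision c.lam (c.rows ψ) d n)⁻¹ *ᵥ
        ((stackedRows (c.rows ψ) d n)ᵀ *ᵥ fun j => excess 0 (d j.1) j.2)) fun d d' h => ?_
    have h1 : stackedRows (c.rows ψ) d n = stackedRows (c.rows ψ) d' n := by
      ext j a
      simp [stackedRows, h j.1 j.1.2]
    have h2 : (fun j : Fin n × Fin (q + 1) => excess 0 (d j.1) j.2) =
        fun j => excess (c := c) 0 (d' j.1) j.2 := by
      ext j
      rw [h j.1 j.1.2]
    rw [precision_congr c.lam (c.rows ψ) h, h1, h2]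

end Posterior

section Adapted

variable {N : ℕ} {ψ : c.Input → Fin N → ℝ} {Ω : Type*} [mΩ : MeasurableSpace Ω]
  {ℱ : Filtration ℕ mΩ} {v : ℕ → Fin (q + 1) → Ω → ℝ} {state : ℕ → Ω → c.State}
  {query : ℕ → Ω → Option c.Pair} {x : ℕ → Ω → ℝ → E} {trigger : ℕ → Ω → Option c.Xμ}

/-- Completion is a function of the safe set, which has finitely many values, and the query.
Trajectories and triggers need no measurability of their own. -/
theorem measurableSet_completed (hc : c.IsRegular)
    (hrun : ∀ ω, c.IsRun (fun n i => v n i ω) (fun n => state n ω) (fun n => query n ω)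
      (fun n => x n ω) (fun n => trigger n ω))
    (hquery : ∀ n d, MeasurableSet[ℱ n] {ω | query (n + 1) ω = some d}) {n : ℕ}
    (hS : ∀ p, MeasurableSet[ℱ n] {ω | p ∈ (state n ω).S}) (t : Option c.Pair) :
    MeasurableSet[ℱ n]
      {ω | completed (fun n => query n ω) (fun n => trigger n ω) n = t} := by
  have hSet (S : Set c.Pair) : MeasurableSet[ℱ n] {ω | (state n ω).S = S} := by
    have : {ω | (state n ω).S = S} =
        ⋂ p : c.Pair, {ω | p ∈ (state n ω).S} ∩ {_ω | p ∈ S} ∪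
          {ω | p ∈ (state n ω).S}ᶜ ∩ {_ω | p ∉ S} := by
      ext ω
      simp only [mem_ofPred_eq, Set.ext_iff, mem_iInter, mem_union, mem_inter_iff, mem_compl_iff]
      exact forall_congr' fun p => by tauto
    rw [this]
    exact MeasurableSet.iInter fun p =>
      ((hS p).inter (MeasurableSet.const _)).union ((hS p).compl.inter (MeasurableSet.const _))
  have hsome (d : c.Pair) : MeasurableSet[ℱ n]
      {ω | completed (fun n => query n ω) (fun n => trigger n ω) n = some d} := by
    have : {ω | completed (fun n => query n ω) (fun n => trigger n ω) n = some d} =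
        {ω | query (n + 1) ω = some d} ∩ ⋃ S : Set c.Pair, {ω | (state n ω).S = S} ∩
          {_ω | d ∈ S ∨ ∀ y, c.IsTrajectory d.1 d.2 y → c.hitTimes S y = ∅} := by
      ext ω
      rw [mem_ofPred_eq, (hrun ω).completed_eq_some_iff hc]
      simp
    rw [this]
    exact (hquery n d).inter (MeasurableSet.iUnion fun S => (hSet S).inter (MeasurableSet.const _))
  cases t with
  | some d => exact hsome d
  | none =>
    have : {ω | completed (fun n => query n ω) (fun n => trigger n ω) n = none} =
        (⋃ d : c.Pair,
          {ω | completed (fun n => query n ω) (fun n => trigger n ω) n = some d})ᶜ := by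
      ext ω
      simp [Option.eq_none_iff_forall_ne_some]
    rw [this]
    exact (MeasurableSet.iUnion hsome).compl

/-- The safe sets and the lower ends of the confidence intervals are adapted, and it is predictable
with which pairs experiments are completed. -/
theorem adapted (hc : c.IsRegular) (hψ : ∀ ζ ζ', c.k ζ ζ' = ψ ζ ⬝ᵥ ψ ζ') (hlam : 0 < c.lam)
    (hv : ∀ n i, Measurable[ℱ (n + 1)] (v (n + 1) i))
    (hrun : ∀ ω, c.IsRun (fun n i => v n i ω) (fun n => state n ω) (fun n => query n ω)
      (fun n => x n ω) (fun n => trigger n ω))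
    (hquery : ∀ n d, MeasurableSet[ℱ n] {ω | query (n + 1) ω = some d}) (n : ℕ) :
    (∀ p, MeasurableSet[ℱ n] {ω | p ∈ (state n ω).S}) ∧
      (∀ p i, Measurable[ℱ n] fun ω => (state n ω).l p i) ∧
      ∀ k < n, ∀ t, MeasurableSet[ℱ k]
        {ω | completed (fun n => query n ω) (fun n => trigger n ω) k = t} := by
  classical
  induction n with
  | zero =>
    simp only [(hrun _).start]
    exact ⟨fun _ => MeasurableSet.const _, fun _ _ => measurable_const, by simp⟩
  | succ n ih =>
    obtain ⟨ihS, ihl, ihD⟩ := ih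
    have hDn := measurableSet_completed hc hrun hquery ihS
    -- The new bounds use the posterior before the new observation, so they are already ℱ
    -- n-measurable.
    have hl (p : c.Pair) (i : Fin (q + 1)) : Measurable[ℱ n] fun ω => (state (n + 1) ω).l p i := by
      have hD' : ∀ k < n, ∀ t, MeasurableSet[ℱ n]
          {ω | completed (fun n => query n ω) (fun n => trigger n ω) k = t} :=
        fun k hk t => ℱ.mono hk.le _ (ihD k hk t)
      have hmean := measurable_postMean_recorded hψ hlam hD' (v := v)
        (fun k hk i => (hv k i).mono (ℱ.mono hk) le_rfl) (p, i)
      have hstd := measurable_postStd_recorded hψ hlam hD' (v := v) (p, i)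
      have hnone : MeasurableSet[ℱ n] {ω | query (n + 1) ω = none} := by
        have : {ω | query (n + 1) ω = none} =
            (⋃ d : c.Pair, {ω | query (n + 1) ω = some d})ᶜ := by
          ext ω
          simp [Option.eq_none_iff_forall_ne_some]
        rw [this]
        exact (MeasurableSet.iUnion (hquery n)).compl
      have hdec : DecidablePred fun ω => query (n + 1) ω = none := Classical.decPred _
      have hite := @Measurable.ite _ _ _ _ (ℱ n) _ _ hdec hnone (ihl p i) ((ihl p i).max
        (hmean.sub (hstd.const_mul √(c.β (n + 1)))).coe_real_ereal)
      convert hite using 2 with ω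
      split_ifs with h
      · rw [((hrun ω).halt n h).2]
      · obtain ⟨d, hd⟩ := Option.ne_none_iff_exists'.1 h
        rw [(hrun ω).l_succ_of_query hd, (hrun ω).data_eq]
        rfl
    refine ⟨fun p => ?_, fun p i => (hl p i).mono (ℱ.mono n.le_succ) le_rfl, fun k hk t => ?_⟩
    · have : {ω | p ∈ (state (n + 1) ω).S} = {ω | p ∈ (state n ω).S} ∪ ⋃ d : c.Pair,
          {ω | completed (fun n => query n ω) (fun n => trigger n ω) n = some d} ∩
            (({ω | d ∈ (state n ω).S}ᶜ ∩ {_ω | p = d}) ∪ ({ω | d ∈ (state n ω).S} ∩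
              ⋂ i : Fin q, ⋃ p' : c.Pair, {ω | p' ∈ (state n ω).S} ∩
                {ω | (c.margin p' p : EReal) ≤ (state (n + 1) ω).l p' i.succ})) := by
        ext ω
        rw [mem_ofPred_eq, (hrun ω).mem_S_succ_iff]
        simp
      rw [this]
      refine ℱ.mono n.le_succ _ ((ihS p).union (MeasurableSet.iUnion fun d => (hDn _).inter
        (((ihS d).compl.inter (MeasurableSet.const _)).union ((ihS d).inter
          (MeasurableSet.iInter fun i => MeasurableSet.iUnion fun p' => (ihS p').inter ?_)))))
      exact (hl p' i.succ) measurableSet_Ici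
    · rcases Nat.lt_succ_iff_lt_or_eq.1 hk with h | rfl
      · exact ihD k h t
      · exact hDn t

end Adapted

end GoSafe

/-! ### The safety theorem -/

theorem theorem1 {P E U : Type*} [NormedAddCommGroup P] [NormedAddCommGroup E] [NormedSpace ℝ E]
    {ℓ q : ℕ} (c : GoSafe P E U ℓ q)
    -- quantization
    (hμ : 0 < c.μ) (hXμ : ∀ y ∈ c.Xμ, y ∈ c.X)
    (hquant : ∀ x ∈ c.X, ‖x - c.quant x‖ ≤ c.μ ∧ ∀ y ∈ c.Xμ, c.l1dist x (c.quant x) ≤ c.l1dist x y)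
    -- the closed loop has a unique trajectory, along which the constraints are bounded below
    (htraj : ∀ a ∈ c.A, ∀ x₁ ∈ c.X, (∃ x, c.IsTrajectory a x₁ x) ∧
      ∀ x x', c.IsTrajectory a x₁ x → c.IsTrajectory a x₁ x' → Set.EqOn x x' (Set.Ici 0))
    (hbdd : ∀ i, ∀ a ∈ c.A, ∀ x₁ ∈ c.X, BddBelow (c.constraintValues i a x₁))
    -- Lipschitz continuity of the constraint functions
    (hLa : 0 ≤ c.La) (hLx : 0 ≤ c.Lx)
    (hLip : ∀ i, ∀ a ∈ c.A, ∀ a' ∈ c.A, ∀ x₁ ∈ c.X, ∀ x₁' ∈ c.X,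
      |c.g i a x₁ - c.g i a' x₁'| ≤ c.La * ‖a - a'‖ + c.Lx * ‖x₁ - x₁'‖)
    -- initial safe set
    (hS₀ : c.S₀.Nonempty) (hS₀safe : ∀ d ∈ c.S₀, ∀ i, c.Lx * c.μ ≤ c.g i d.1 d.2)
    -- the surrogate is bounded by `B` in the RKHS of the kernel; the reward function need not be,
    -- if the kernel models the reward as independent of the constraints
    {H : Type*} [NormedAddCommGroup H] [InnerProductSpace ℝ H] [CompleteSpace H]
    [RKHS ℝ H c.Input ℝ] (hk : ∀ ζ ζ', c.k ζ ζ' = RKHS.kernel H ζ ζ' 1)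
    (B : ℝ) (φ : H) (hB : ‖φ‖ ≤ B) (hφ : ∀ d (i : Fin q), φ (d, i.succ) = c.h d i.succ)
    (hφ0 : (∀ d, φ (d, 0) = c.h d 0) ∨ ∀ d d' (i : Fin q), c.k (d, 0) (d', i.succ) = 0)
    -- measurement noise, and experiments that depend only on the past
    {Ω : Type*} [mΩ : MeasurableSpace Ω] (ℙ : Measure Ω) [IsProbabilityMeasure ℙ]
    (ℱ : Filtration ℕ mΩ) (σ : ℝ) (hσ : 0 < σ)
    (v : ℕ → Fin (q + 1) → Ω → ℝ) (hv : SubGaussianNoise ℙ ℱ σ v)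
    (state : ℕ → Ω → c.State) (query : ℕ → Ω → Option c.Pair) (x : ℕ → Ω → ℝ → E)
    (trigger : ℕ → Ω → Option c.Xμ)
    (hrun : ∀ ω, c.IsRun (fun n i => v n i ω) (fun n => state n ω) (fun n => query n ω)
      (fun n => x n ω) (fun n => trigger n ω))
    (hquery : ∀ n d, MeasurableSet[ℱ n] {ω | query (n + 1) ω = some d})
    -- confidence parameters; the choice `√β_n = B + 4 σ √(γ + 1 + ln (1/δ))` is admissible as soon as
    -- the noise variance `lam` of the Gaussian process model is at least `1/8`
    (δ : ℝ) (hδ : δ ∈ Set.Ioo (0 : ℝ) 1) (hlam : 0 < c.lam)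
    (hβ : ∀ n ≥ 1, B + σ / √c.lam *
      √(2 * (c.infoCapacity ((n - 1) * (q + 1)) + 1 + Real.log (1 / δ))) ≤ √(c.β n)) :
    ∃ G : Set Ω, MeasurableSet G ∧ ENNReal.ofReal (1 - δ) ≤ ℙ G ∧
      ∀ ω ∈ G, ∀ n ≥ 1, query n ω ≠ none → ∀ t ≥ 0, ∀ i, 0 ≤ c.gbar i (x n ω t) := by
  have hc : c.IsRegular := ⟨hμ, hXμ, hquant, htraj, hbdd, hLx, hLip⟩
  have : Nonempty c.Pair := hS₀.to_type
  obtain ⟨N, ψ, w, hψ', hφw, hw⟩ := RKHS.exists_features φ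
  have hψ : ∀ ζ ζ', c.k ζ ζ' = dotProduct (ψ ζ) (ψ ζ') := fun ζ ζ' =>
    (hk ζ ζ').trans (hψ' ζ ζ')
  set D : ℕ → Ω → Option c.Pair :=
    fun k ω => GoSafe.completed (fun n => query n ω) (fun n => trigger n ω) k with hD
  have hDm : ∀ n t, MeasurableSet[ℱ n] {ω | D n ω = t} := fun n =>
    (GoSafe.adapted hc hψ hlam (fun n => (hv n).1) hrun hquery (n + 1)).2.2 n n.lt_succ_self
  set Y : ℕ → Ω → ℝ :=
    fun n ω => mixture c.lam σ (c.rows ψ) (fun k => D k ω) (fun k i => v k i ω) n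
  have hYm (n : ℕ) : Measurable (Y n) :=
    (measurable_mixture (fun n => (hv n).1) none c.lam (c.rows ψ) hDm n).mono (ℱ.le n) le_rfl
  have hmeas : MeasurableSet {ω | ∃ n, 1 / δ < Y n ω} := by
    simp only [ofPred_exists]
    exact MeasurableSet.iUnion fun n => (hYm n) measurableSet_Ioi
  -- On this event all confidence intervals hold in all iterations, and the rest is deterministic.
  refine ⟨{ω | ∃ n, 1 / δ < Y n ω}ᶜ, hmeas.compl, ?_, ?_⟩
  · rw [prob_compl_eq_one_sub hmeas, ENNReal.ofReal_sub _ hδ.1.le, ENNReal.ofReal_one]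
    exact tsub_le_tsub_left
      (hv.measure_exists_mixture_gt_le hσ hlam (c.rows ψ) GoSafe.rows_none hDm hδ.1) 1
  · intro ω hω n hn hq t ht i
    obtain ⟨n, rfl⟩ := Nat.exists_eq_succ_of_ne_zero (Nat.one_le_iff_ne_zero.1 hn)
    obtain ⟨d, hd⟩ := Option.ne_none_iff_exists'.1 hq
    refine (hrun ω).gbar_nonneg hc hS₀safe (fun m p j => ?_) hd ht i
    rw [(hrun ω).data_eq]
    refine GoSafe.abs_h_sub_postMean_le _ _ hψ hlam hφw (hw.trans hB) hφ hφ0 hσ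
      (not_lt.1 fun h => hω ⟨m, h⟩) ?_ p j
    simpa using hβ (m + 1) (Nat.le_add_left 1 m)
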